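/- Let $S_\infty=\bigcup_n S_n$, with simple transpositions $s_i=(i,i+1)$, and let $\ell(\varpi)$ be the least number of factors in an expression of $\varpi$ as a product of simple transpositions. The code of $\varpi\in S_\infty$ is the sequence $\gamma_i=\#\{j>i : \varpi_j<\varpi_i\}$, $i\ge 1$, and the shape $\lambda=\lambda(\varpi)$ is the partition whose parts are the non-zero entries of the code, in weakly decreasing order. $\varpi$ is dominant if its code is weakly decreasing, and it is amenable if $\varpi=\hat\varpi\,\omega$ with $\hat\varpi$ dominant, $\omega$ $231$-avoiding, and $\ell(\hat\varpi\omega)=\ell(\hat\varpi)-\ell(\omega)$. Let $\ell$ be the number of parts of $\lambda$ and put $\lambda_{\ell+1}=0$. The right flag $\mathfrak f(\varpi)$ and the left flag $\mathfrak g(\varpi)$ are the sequences of length $\ell$ given by $$\mathfrak f_j=\max\{i : \gamma_i\ge\lambda_j\},\qquad \mathfrak g_j=\mathfrak f_c+\lambda_c-c,$$ where $c$ is the least integer with $c\ge j$ and $\lambda_c>\lambda_{c+1}$. On $\mathbb Z[X,Y]=\mathbb Z[x_1,x_2,\ldots,y_1,y_2,\ldots]$ let $\partial^x_i f=(f-s_if)/(x_i-x_{i+1})$,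 where $s_i$ exchanges $x_i$ and $x_{i+1}$, and let $\partial_i^y=\pi\partial_i^x\pi$, where $\pi$ is the ring involution with $\pi(x_i)=-y_i$ and $\pi(y_i)=-x_i$. The double Schubert polynomials of Lascoux and Schützenberger are the unique family $(\mathfrak S_\varpi)_{\varpi\in S_\infty}$ in $\mathbb Z[X,Y]$ such that for all $\varpi$ and all $i\ge1$: $\partial^x_i\mathfrak S_\varpi$ is $\mathfrak S_{\varpi s_i}$ if $\ell(\varpi s_i)<\ell(\varpi)$ and $0$ otherwise; $\partial^y_i\mathfrak S_\varpi$ is $\mathfrak S_{s_i\varpi}$ if $\ell(s_i\varpi)<\ell(\varpi)$ and $0$ otherwise; and the constant term of $\mathfrak S_\varpi$ is $1$ if $\varpi=1$ and $0$ otherwise. For $r\geq 0$ let $h^r_p(Z)$ and $e^r_p(Z)$ be the complete and elementary symmetric polynomials of degree $p$ in $z_1,\ldots,z_r$, and for $r<0$ let $h^r_p(Z)=e^{-r}_p(Z)$ and $e^r_p(Z)=h^{-r}_p(Z)$. For $p,r,t\in\mathbb Z$ put ${}^rh^t_p=\sum_{i=0}^p h^r_i(X)\,e^t_{p-i}(-Y)$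 (so ${}^rh^t_p=0$ for $p<0$), and for finitely supported integer sequences put ${}^\rho h^\beta_\alpha=\prod_k {}^{\rho_k}h^{\beta_k}_{\alpha_k}$. Let $R^\emptyset=\prod_{i<j}(1-R_{ij})$, where the raising operator $R_{ij}$ adds $1$ to $\alpha_i$ and subtracts $1$ from $\alpha_j$, and a product $R$ of raising operators acts by $R\,{}^\rho h^\beta_\alpha={}^\rho h^\beta_{R\alpha}$, extended linearly. Theorem. The family of double Schubert polynomials exists and is unique, and for every amenable permutation $\varpi$, $$\mathfrak S_\varpi=R^\emptyset\;{}^{\mathfrak f(\varpi)}h^{\mathfrak g(\varpi)}_{\lambda(\varpi)}.$$ -/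

import Mathlib

/-!
All positions, values and variables are numbered from `0`: the index `i` here stands for the
index `i + 1` of the usual one-line notation, so a permutation `(ϖ₁, ϖ₂, …)` of the positive
integers is a permutation of `ℕ`, `s i` exchanges `i` and `i + 1`, and the first `r` variables
are `x 0, …, x (r - 1)`.
-/

namespace TypeA

open MvPolynomial

noncomputable section

/-! ### The infinite symmetric group -/

/-- `S_∞`, the union over `n` of the groups `S_n` of permutations fixing every `i ≥ n`. -/
def SInf : Subgroup (Equiv.Perm ℕ) where
  carrier := {w | ∃ n, ∀ i, n ≤ i → w i = i}
  one_mem' := ⟨0, fun _ _ => rfl⟩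
  mul_mem' := by
    rintro a b ⟨m, hm⟩ ⟨n, hn⟩
    refine ⟨max m n, fun i hi => ?_⟩
    rw [Equiv.Perm.mul_apply, hn i (le_trans (le_max_right _ _) hi),
      hm i (le_trans (le_max_left _ _) hi)]
  inv_mem' := by
    rintro a ⟨n, hn⟩
    refine ⟨n, fun i hi => ?_⟩
    rw [Equiv.Perm.inv_eq_iff_eq, hn i hi]

/-- The simple transposition exchanging `i` and `i + 1`. -/
def s (i : ℕ) : SInf :=
  ⟨Equiv.swap i (i + 1), i + 2, fun _ hj =>
    Equiv.swap_apply_of_ne_of_ne (by omega) (by omega)⟩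

/-- The length: the least number of factors in an expression of `w` as a product of simple
transpositions. -/
def length (w : SInf) : ℕ :=
  sInf {r | ∃ l : List ℕ, l.length = r ∧ (l.map s).prod = w}

/-- The code: `γ_i = #{j > i | w_j < w_i}`. -/
def code (w : SInf) (i : ℕ) : ℕ :=
  {j : ℕ | i < j ∧ w.1 j < w.1 i}.ncard

/-- The least `n` such that `w` lies in `S_n`. All entries `γ_i` of the code with `i ≥ n` are
zero. -/
def rank (w : SInf) : ℕ :=
  sInf {n | ∀ i, n ≤ i → w.1 i = i}

/-- The shape: the non-zero entries of the code (with multiplicity) in weakly decreasing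
order. -/
def shape (w : SInf) : List ℕ :=
  (((Multiset.range (rank w)).map (code w)).filter (· ≠ 0)).sort (· ≥ ·)

/-- The `j`-th part of the shape, equal to `0` beyond the last part. -/
def part (w : SInf) (j : ℕ) : ℕ :=
  (shape w).getD j 0

/-- `w` is dominant if its code is a partition, that is, weakly decreasing. -/
def IsDominant (w : SInf) : Prop :=
  Antitone (code w)

/-- `w` contains no subword with the same relative order as `(2, 3, 1)`. -/
def Avoids231 (w : SInf) : Prop :=
  ¬ ∃ i j k : ℕ, i < j ∧ j < k ∧ w.1 k < w.1 i ∧ w.1 i < w.1 j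

/-- `w` is a (right) modification of `v`. -/
def IsModification (w v : SInf) : Prop :=
  ∃ u : SInf, Avoids231 u ∧ w = v * u ∧ length (v * u) + length u = length v

/-- `w` is amenable if it is a modification of a dominant permutation. -/
def IsAmenable (w : SInf) : Prop :=
  ∃ v : SInf, IsDominant v ∧ IsModification w v

/-- The right flag: `f_j = max {i | γ_i ≥ λ_j}` as a position numbered from `1`, for the indices
`j` of the parts of the shape; extended by zero. -/
def rightFlag (w : SInf) (j : ℕ) : ℤ :=
  if j < (shape w).length then ((sSup {i : ℕ | part w j ≤ code w i} : ℕ) : ℤ) + 1 else 0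

/-- The least index `c ≥ j` with `λ_c > λ_{c+1}`. -/
def corner (w : SInf) (j : ℕ) : ℕ :=
  sInf {c : ℕ | j ≤ c ∧ part w (c + 1) < part w c}

/-- The left flag: `g_j = f_c + λ_c - c`, where `c` is the least index with `c ≥ j` and
`λ_c > λ_{c+1}` (numbered from `1` in this formula), for the indices `j` of the parts of the
shape; extended by zero. -/
def leftFlag (w : SInf) (j : ℕ) : ℤ :=
  if j < (shape w).length then
    rightFlag w (corner w j) + part w (corner w j) - ((corner w j : ℤ) + 1)
  else 0

/-! ### Polynomials and divided differences -/

/-- The polynomial ring `ℤ[X, Y]` in the variables `x i` and `y i`. -/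
abbrev Poly : Type := MvPolynomial (ℕ ⊕ ℕ) ℤ

/-- The variable `x i`. -/
def x (i : ℕ) : Poly := X (Sum.inl i)

/-- The variable `y i`. -/
def y (i : ℕ) : Poly := X (Sum.inr i)

/-- The automorphism of `ℤ[X, Y]` exchanging `x i` and `x (i + 1)` and fixing all other
variables. -/
def sAct (i : ℕ) : Poly →ₐ[ℤ] Poly :=
  rename (Equiv.swap (Sum.inl i) (Sum.inl (i + 1)))

theorem x_sub_dvd (i : ℕ) (f : Poly) : x i - x (i + 1) ∣ f - sAct i f := by
  induction f using MvPolynomial.induction_on with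
  | C a => simp [sAct]
  | add p q hp hq =>
    rw [map_add, add_sub_add_comm]
    exact dvd_add hp hq
  | mul_X p v hp =>
    have hv : x i - x (i + 1) ∣ (X v : Poly) - sAct i (X v) := by
      simp only [sAct, rename_X, x]
      by_cases h1 : v = Sum.inl i
      · subst h1; rw [Equiv.swap_apply_left]
      · by_cases h2 : v = Sum.inl (i + 1)
        · subst h2; rw [Equiv.swap_apply_right, ← neg_sub]
          exact (neg_dvd (α := Poly)).2 dvd_rfl
        · rw [Equiv.swap_apply_of_ne_of_ne h1 h2, sub_self]; exact dvd_zero _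
    have : p * X v - sAct i (p * X v)
        = (p - sAct i p) * X v + sAct i p * (X v - sAct i (X v)) := by
      rw [map_mul]; ring
    rw [this]
    exact dvd_add (hp.mul_right _) (hv.mul_left _)

/-- The divided difference `∂^x_i f = (f - s_i f) / (x_i - x_{i+1})`, an exact quotient in
`ℤ[X, Y]`. -/
def ddX (i : ℕ) (f : Poly) : Poly :=
  Classical.choose (x_sub_dvd i f)

theorem ddX_spec (i : ℕ) (f : Poly) : f - sAct i f = (x i - x (i + 1)) * ddX i f :=
  Classical.choose_spec (x_sub_dvd i f)

/-- The ring involution with `x i ↦ -y i` and `y i ↦ -x i`. -/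
def invol : Poly →ₐ[ℤ] Poly :=
  aeval (Sum.elim (fun i => -y i) (fun i => -x i))

/-- The divided difference `∂^y_i = π ∂^x_i π`, where `π` is the involution `invol`. -/
def ddY (i : ℕ) (f : Poly) : Poly :=
  invol (ddX i (invol f))

/-- The defining properties of the family of double Schubert polynomials of Lascoux and
Schützenberger. -/
structure IsDoubleSchubertFamily (S : SInf → Poly) : Prop where
  ddX_eq : ∀ (w : SInf) (i : ℕ),
    ddX i (S w) = if length (w * s i) < length w then S (w * s i) else 0
  ddY_eq : ∀ (w : SInf) (i : ℕ),
    ddY i (S w) = if length (s i * w) < length w then S (s i * w) else 0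
  constantCoeff_one : constantCoeff (S 1) = 1
  constantCoeff_of_ne_one : ∀ w : SInf, w ≠ 1 → constantCoeff (S w) = 0

/-! ### Flagged Jacobi–Trudi expressions -/

/-- `h^r_p(Z)`: the complete symmetric polynomial of degree `p` in the first `r` variables if
`r ≥ 0`, and the elementary symmetric polynomial `e^{-r}_p(Z)` if `r < 0`. -/
def hSym (z : ℕ → Poly) (r : ℤ) (p : ℕ) : Poly :=
  if 0 ≤ r then aeval (fun k : Fin r.toNat => z k) (hsymm (Fin r.toNat) ℤ p)
  else aeval (fun k : Fin (-r).toNat => z k) (esymm (Fin (-r).toNat) ℤ p)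

/-- `e^r_p(Z)`: the elementary symmetric polynomial of degree `p` in the first `r` variables if
`r ≥ 0`, and the complete symmetric polynomial `h^{-r}_p(Z)` if `r < 0`. -/
def eSym (z : ℕ → Poly) (r : ℤ) (p : ℕ) : Poly :=
  if 0 ≤ r then aeval (fun k : Fin r.toNat => z k) (esymm (Fin r.toNat) ℤ p)
  else aeval (fun k : Fin (-r).toNat => z k) (hsymm (Fin (-r).toNat) ℤ p)

/-- `^r h^t_p = ∑_{i=0}^p h^r_i(X) e^t_{p-i}(-Y)`, which is `0` for `p < 0`. -/
def h (r t p : ℤ) : Poly :=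
  if 0 ≤ p then
    ∑ i ∈ Finset.range (p.toNat + 1), hSym x r i * eSym (fun k => -y k) t (p.toNat - i)
  else 0

/-- `^ρ h^β_α = ∏_k ^{ρ_k} h^{β_k}_{α_k}` for integer sequences with finite support. -/
def hSeq (ρ β α : ℕ → ℤ) : Poly :=
  ∏ᶠ k : ℕ, h (ρ k) (β k) (α k)

/-- The pairs `(i, j)` with `i < j`. -/
abbrev Pair : Type := {p : ℕ × ℕ // p.1 < p.2}

/-- The action on integer sequences of the raising operator `∏_{(i,j) ∈ D} R_{ij}`, where
`R_{ij}` adds `1` to the entry `i` and subtracts `1` from the entry `j`. -/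
def raise (D : Finset Pair) (α : ℕ → ℤ) : ℕ → ℤ :=
  α + ∑ p ∈ D, (Pi.single p.1.1 1 - Pi.single p.1.2 1)

/-- `R^∅ ^ρ h^β_α`, where `R^∅ = ∏_{i<j} (1 - R_{ij}) = ∑_D (-1)^{|D|} ∏_{(i,j) ∈ D} R_{ij}`, the
sum over all finite sets `D` of pairs `i < j`. Only finitely many terms are non-zero when `ρ`,
`β`, `α` have finite support: the last entry lowered by the operator of `D` must not become
negative. -/
def jacobiTrudi (ρ β α : ℕ → ℤ) : Poly :=
  ∑ᶠ D : Finset Pair, (-1) ^ D.card * hSeq ρ β (raise D α)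

theorem h_zero_zero_zero : h 0 0 0 = 1 := by
  simp [h, hSym, eSym, MvPolynomial.hsymm_zero, MvPolynomial.esymm_zero]

theorem raise_apply (D : Finset Pair) (α : ℕ → ℤ) (k : ℕ) :
    raise D α k = α k + ∑ p ∈ D, ((if k = p.1.1 then 1 else 0) - if k = p.1.2 then 1 else 0) := by
  simp [raise, Finset.sum_apply, Pi.single_apply]

/-- The sum defining `jacobiTrudi` is a finite sum over the sets of pairs below `ℓ`, for
sequences that vanish from the index `ℓ` on. -/
theorem support_jacobiTrudi (ρ β α : ℕ → ℤ) (l : ℕ) (hρ : ∀ k, l ≤ k → ρ k = 0)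
    (hβ : ∀ k, l ≤ k → β k = 0) (hα : ∀ k, l ≤ k → α k = 0) (D : Finset Pair)
    (hD : (-1) ^ D.card * hSeq ρ β (raise D α) ≠ 0) : ∀ p ∈ D, p.1.2 < l := by
  by_contra! hcon
  obtain ⟨q, hq, hql⟩ := hcon
  apply hD
  obtain ⟨m, hm, hmax⟩ := D.exists_max_image (fun p => p.1.2) ⟨q, hq⟩
  have hml : l ≤ m.1.2 := le_trans hql (hmax q hq)
  have hneg : raise D α m.1.2 < 0 := by
    rw [raise_apply, hα _ hml, zero_add, ← Finset.add_sum_erase _ _ hm]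
    have h1 : (if m.1.2 = m.1.1 then (1 : ℤ) else 0) - (if m.1.2 = m.1.2 then 1 else 0) = -1 := by
      have := m.2
      rw [if_neg (by omega), if_pos rfl]; norm_num
    rw [h1]
    have h2 : ∑ p ∈ D.erase m, ((if m.1.2 = p.1.1 then (1 : ℤ) else 0)
        - if m.1.2 = p.1.2 then 1 else 0) ≤ 0 := by
      apply Finset.sum_nonpos
      intro p hp
      have h3 := hmax p (Finset.mem_of_mem_erase hp)
      have h4 := p.2
      rw [if_neg (by omega)]
      split_ifs <;> norm_num
    linarith
  have hfin : (Function.mulSupport fun k => h (ρ k) (β k) (raise D α k)).Finite := by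
    apply (Set.finite_Iic m.1.2).subset
    intro k hk
    by_contra hkm
    simp only [Set.mem_Iic, not_le] at hkm
    apply hk
    have hkl : l ≤ k := by omega
    have : raise D α k = 0 := by
      rw [raise_apply, hα _ hkl, zero_add]
      apply Finset.sum_eq_zero
      intro p hp
      have h3 := hmax p hp
      have h4 := p.2
      rw [if_neg (by omega), if_neg (by omega), sub_zero]
    simp only
    rw [this, hρ _ hkl, hβ _ hkl, h_zero_zero_zero]
  have : hSeq ρ β (raise D α) = 0 := by
    unfold hSeq
    rw [finprod_eq_prod _ hfin]
    have hz : h (ρ m.1.2) (β m.1.2) (raise D α m.1.2) = 0 := by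
      unfold h; rw [if_neg (by omega)]
    refine Finset.prod_eq_zero (i := m.1.2) ?_ hz
    rw [Set.Finite.mem_toFinset, Function.mem_mulSupport, hz]
    exact zero_ne_one
  rw [this, mul_zero]

end

end TypeA

namespace TypeA

open MvPolynomial

noncomputable section

/-! ### Divided differences -/

/-! Existence. For each `n`, start from the staircase product `base n` at the longest element of
`S_n` and descend by divided differences along ascents. The braid and commutation relations make the
result independent of the path (`ddX_confluent`, `isFam_fam`). The polynomial of a dominant
permutation is the product of `x i - y j` over the diagram of its code (`IsFam.dominant`). In
particular the longest element of `S_n` keeps its polynomial inside `S_{n+1}`, so the families for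
different `n` agree. The `y`-relations hold because the two kinds of divided differences commute and
`base n` is symmetric under `invol`; constant terms vanish by homogeneity. Uniqueness. By induction
on length, the difference of two families at `w` is killed by all divided differences, hence
invariant under all simple transpositions of both alphabets. A polynomial involves finitely many
variables, so it is constant, and the constant term is prescribed.

The formula. The Vandermonde identity for Laurent monomials turns the raising operator expression
into a determinant (`jacobiTrudi_eq_det`) whose entries are coefficients of the series `gf r t`. For
dominant `v`, the determinant with flags `k + 1` and `code v k` becomes triangular after column
operations and equals the product over the diagram (`det_jtMatrix_diagram`). For `v * u` with `u`
avoiding `231`, write `c k` for `code u⁻¹ k`, the number of larger entries to the left of `k` in the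
word of `u`. Removing a suitable descent from `u` at each stage, the divided difference acts on a
single row: it raises that row's flag by one and lowers its degree by one. The outcome is a
determinant with flags `k + 1 + c k`, `code v k` and parts `code v k - c k` (`IsFam.modification`).
These parts are the code of `v * u`, rearranged into decreasing order (`code_modification`,
`reduced_code_antitone`). Within a block of equal parts, consecutive flags change the series by one
linear factor, so unitriangular row operations replace all flags in the block by those of its last
row, which are the right and left flags (`jacobiTrudi_amenable`). -/

theorem x_sub_ne_zero {i j : ℕ} (hij : i ≠ j) : x i - x j ≠ 0 := by
  rw [sub_ne_zero]
  intro e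
  exact hij (Sum.inl_injective (X_injective e))

theorem x_sub_y_ne_zero (i j : ℕ) : x i - y j ≠ 0 := by
  rw [sub_ne_zero]
  intro e
  have := X_injective (R := ℤ) e
  cases this

theorem sAct_x (i k : ℕ) : sAct i (x k) = x (Equiv.swap i (i + 1) k) := by
  simp only [sAct, x, rename_X]
  congr 1
  simp only [Equiv.swap_apply_def, Sum.inl.injEq]
  split_ifs <;> rfl

theorem sAct_y (i k : ℕ) : sAct i (y k) = y k := by
  simp only [sAct, y, rename_X]
  congr 1

theorem sAct_sAct (i : ℕ) (f : Poly) : sAct i (sAct i f) = f := by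
  simp only [sAct, rename_rename]
  have : (Equiv.swap (Sum.inl i) (Sum.inl (i + 1)) : Equiv.Perm (ℕ ⊕ ℕ)) ∘
      (Equiv.swap (Sum.inl i) (Sum.inl (i + 1))) = id := by
    funext v; simp
  rw [this, rename_id_apply]

theorem algHom_ext_xy {A : Type*} [CommSemiring A] [Algebra ℤ A] {f g : Poly →ₐ[ℤ] A}
    (hx : ∀ k, f (x k) = g (x k)) (hy : ∀ k, f (y k) = g (y k)) : f = g := by
  apply MvPolynomial.algHom_ext
  rintro (k | k)
  · exact hx k
  · exact hy k

/-- `ddX` is obtained by choice, but `ℤ[X, Y]` is a domain, so exhibiting any quotient computes it.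
-/
theorem ddX_unique {i : ℕ} {f g : Poly} (e : f - sAct i f = (x i - x (i + 1)) * g) :
    ddX i f = g := by
  have h1 := ddX_spec i f
  rw [e] at h1
  exact (mul_left_cancel₀ (x_sub_ne_zero (by omega)) h1).symm

theorem ddX_zero (i : ℕ) : ddX i 0 = 0 := ddX_unique (by simp)

theorem ddX_sub (i : ℕ) (f g : Poly) : ddX i (f - g) = ddX i f - ddX i g := by
  apply ddX_unique
  rw [map_sub, mul_sub, ← ddX_spec, ← ddX_spec]; ring

theorem ddX_eq_zero_iff {i : ℕ} {f : Poly} : ddX i f = 0 ↔ sAct i f = f := by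
  constructor
  · intro e
    have := ddX_spec i f
    rw [e, mul_zero, sub_eq_zero] at this
    exact this.symm
  · intro e
    exact ddX_unique (by rw [e]; ring)

theorem ddX_mul_fixed {i : ℕ} {q : Poly} (hq : sAct i q = q) (p : Poly) :
    ddX i (p * q) = ddX i p * q := by
  apply ddX_unique
  rw [map_mul, hq, ← mul_assoc, ← ddX_spec]; ring

theorem ddX_x_sub_y (i j : ℕ) : ddX i (x i - y j) = 1 := by
  apply ddX_unique
  rw [map_sub, sAct_x, sAct_y, Equiv.swap_apply_left]; ring

/-- Numerator and denominator both change sign under `sAct i`. -/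
theorem sAct_ddX (i : ℕ) (f : Poly) : sAct i (ddX i f) = ddX i f := by
  have h1 := congrArg (sAct i) (ddX_spec i f)
  rw [map_sub, sAct_sAct, map_mul, map_sub, sAct_x, sAct_x, Equiv.swap_apply_left,
    Equiv.swap_apply_right, ← neg_sub, ddX_spec, ← neg_sub (x i), neg_mul, neg_inj] at h1
  exact (mul_left_cancel₀ (x_sub_ne_zero (by omega)) h1).symm

theorem ddX_ddX_self (i : ℕ) (f : Poly) : ddX i (ddX i f) = 0 :=
  ddX_eq_zero_iff.2 (sAct_ddX i f)

theorem sAct_comm {i j : ℕ} (hij : i + 1 < j) (f : Poly) :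
    sAct i (sAct j f) = sAct j (sAct i f) := by
  have : (sAct i).comp (sAct j) = (sAct j).comp (sAct i) := by
    apply algHom_ext_xy <;> intro k
    · change sAct i (sAct j (x k)) = sAct j (sAct i (x k))
      simp only [sAct_x]
      congr 1
      simp only [Equiv.swap_apply_def]
      split_ifs <;> omega
    · change sAct i (sAct j (y k)) = sAct j (sAct i (y k))
      simp only [sAct_y]
  exact DFunLike.congr_fun this f

theorem sAct_braid (i : ℕ) (f : Poly) :
    sAct i (sAct (i + 1) (sAct i f)) = sAct (i + 1) (sAct i (sAct (i + 1) f)) := by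
  have : (sAct i).comp ((sAct (i + 1)).comp (sAct i)) =
      (sAct (i + 1)).comp ((sAct i).comp (sAct (i + 1))) := by
    apply algHom_ext_xy <;> intro k
    · change sAct i (sAct (i + 1) (sAct i (x k))) = sAct (i + 1) (sAct i (sAct (i + 1) (x k)))
      simp only [sAct_x]
      congr 1
      simp only [Equiv.swap_apply_def]
      split_ifs <;> omega
    · change sAct i (sAct (i + 1) (sAct i (y k))) = sAct (i + 1) (sAct i (sAct (i + 1) (y k)))
      simp only [sAct_y]
  exact DFunLike.congr_fun this f

/-- The denominators are fixed by the other transposition, so both sides are the quotient of the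
same alternating sum over `{1, s_i, s_j, s_i s_j}`. -/
theorem ddX_comm {i j : ℕ} (hij : i + 1 < j) (f : Poly) :
    ddX i (ddX j f) = ddX j (ddX i f) := by
  have hi : ∀ k, (k = i ∨ k = i + 1) → sAct j (x k) = x k := by
    intro k hk
    rw [sAct_x, Equiv.swap_apply_of_ne_of_ne (by omega) (by omega)]
  have hj : ∀ k, (k = j ∨ k = j + 1) → sAct i (x k) = x k := by
    intro k hk
    rw [sAct_x, Equiv.swap_apply_of_ne_of_ne (by omega) (by omega)]
  have e1 := ddX_spec j f
  have e2 := congrArg (sAct i) e1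
  rw [map_sub, map_mul, map_sub, hj _ (.inl rfl), hj _ (.inr rfl)] at e2
  have e3 := ddX_spec i f
  have e4 := congrArg (sAct j) e3
  rw [map_sub, map_mul, map_sub, hi _ (.inl rfl), hi _ (.inr rfl)] at e4
  have e5 := ddX_spec i (ddX j f)
  have e6 := ddX_spec j (ddX i f)
  have e7 := sAct_comm hij f
  apply mul_left_cancel₀ (x_sub_ne_zero (show i ≠ i + 1 by omega))
  apply mul_left_cancel₀ (x_sub_ne_zero (show j ≠ j + 1 by omega))
  linear_combination (-(x j - x (j + 1))) * e5 + (x i - x (i + 1)) * e6 + (-e1 + e2 + e3 - e4 + e7)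

/-- Cleared of denominators, the triple divided difference is the antisymmetrizer over `S_3`. The
mirror identity has the same right-hand side up to the braid relation for `sAct`, and this gives
`ddX_braid`. -/
theorem ddX_triple_left (i : ℕ) (f : Poly) :
    (x i - x (i + 1)) * (x (i + 1) - x (i + 2)) * (x i - x (i + 2)) *
      ddX i (ddX (i + 1) (ddX i f)) =
    f - sAct i f - sAct (i + 1) f + sAct (i + 1) (sAct i f) + sAct i (sAct (i + 1) f)
      - sAct i (sAct (i + 1) (sAct i f)) := by
  have a0 : sAct i (x i) = x (i + 1) := by rw [sAct_x, Equiv.swap_apply_left]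
  have a1 : sAct i (x (i + 1)) = x i := by rw [sAct_x, Equiv.swap_apply_right]
  have a2 : sAct i (x (i + 2)) = x (i + 2) := by
    rw [sAct_x, Equiv.swap_apply_of_ne_of_ne (by omega) (by omega)]
  have b0 : sAct (i + 1) (x i) = x i := by
    rw [sAct_x, Equiv.swap_apply_of_ne_of_ne (by omega) (by omega)]
  have b1 : sAct (i + 1) (x (i + 1)) = x (i + 2) := by rw [sAct_x, Equiv.swap_apply_left]
  have e1 := ddX_spec i f
  have e2 := congrArg (sAct (i + 1)) e1
  have e3 := ddX_spec (i + 1) (ddX i f)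
  have e4 := congrArg (sAct i) e3
  have e5 := congrArg (sAct i) e2
  have e6 := ddX_spec i (ddX (i + 1) (ddX i f))
  simp only [map_sub, map_mul, a0, a1, a2, b0, b1, sAct_ddX, add_assoc, Nat.reduceAdd]
    at e1 e2 e3 e4 e5 e6
  apply mul_left_cancel₀ (x_sub_ne_zero (show i ≠ i + 1 by omega))
  generalize x i = a at *
  generalize x (i + 1) = b at *
  generalize x (i + 2) = c at *
  linear_combination (-(a - b) * (b - c) * (a - c)) * e6 + (-(a - b) * (a - c)) * e3
    + ((a - b) * (b - c)) * e4 - (a - b) * e1 + (a - b) * e2 - (a - b) * e5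

theorem ddX_triple_right (i : ℕ) (f : Poly) :
    (x i - x (i + 1)) * (x (i + 1) - x (i + 2)) * (x i - x (i + 2)) *
      ddX (i + 1) (ddX i (ddX (i + 1) f)) =
    f - sAct i f - sAct (i + 1) f + sAct (i + 1) (sAct i f) + sAct i (sAct (i + 1) f)
      - sAct (i + 1) (sAct i (sAct (i + 1) f)) := by
  have a1 : sAct i (x (i + 1)) = x i := by rw [sAct_x, Equiv.swap_apply_right]
  have a2 : sAct i (x (i + 2)) = x (i + 2) := by
    rw [sAct_x, Equiv.swap_apply_of_ne_of_ne (by omega) (by omega)]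
  have b0 : sAct (i + 1) (x i) = x i := by
    rw [sAct_x, Equiv.swap_apply_of_ne_of_ne (by omega) (by omega)]
  have b1 : sAct (i + 1) (x (i + 1)) = x (i + 2) := by rw [sAct_x, Equiv.swap_apply_left]
  have b2 : sAct (i + 1) (x (i + 2)) = x (i + 1) := by rw [sAct_x, Equiv.swap_apply_right]
  have e1 := ddX_spec (i + 1) f
  have e2 := congrArg (sAct i) e1
  have e3 := ddX_spec i (ddX (i + 1) f)
  have e4 := congrArg (sAct (i + 1)) e3
  have e5 := congrArg (sAct (i + 1)) e2
  have e6 := ddX_spec (i + 1) (ddX i (ddX (i + 1) f))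
  simp only [map_sub, map_mul, a1, a2, b0, b1, b2, sAct_ddX, add_assoc, Nat.reduceAdd]
    at e1 e2 e3 e4 e5 e6
  apply mul_left_cancel₀ (x_sub_ne_zero (show i + 1 ≠ i + 2 by omega))
  generalize x i = a at *
  generalize x (i + 1) = b at *
  generalize x (i + 2) = c at *
  linear_combination (-(a - b) * (b - c) * (a - c)) * e6 + (-(b - c) * (a - c)) * e3
    + ((a - b) * (b - c)) * e4 - (b - c) * e1 + (b - c) * e2 - (b - c) * e5

theorem ddX_braid (i : ℕ) (f : Poly) :
    ddX i (ddX (i + 1) (ddX i f)) = ddX (i + 1) (ddX i (ddX (i + 1) f)) := by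
  have h1 := ddX_triple_left i f
  rw [sAct_braid, ← ddX_triple_right i f] at h1
  refine mul_left_cancel₀ (mul_ne_zero (mul_ne_zero ?_ ?_) ?_) h1 <;>
    exact x_sub_ne_zero (by omega)

/-! ### The involution and the divided differences in the second set of variables -/

theorem invol_x (i : ℕ) : invol (x i) = -y i := by simp [invol, x]

theorem invol_y (i : ℕ) : invol (y i) = -x i := by simp [invol, y]

theorem invol_invol (f : Poly) : invol (invol f) = f := by
  have : invol.comp invol = AlgHom.id ℤ Poly := by
    apply algHom_ext_xy <;> intro k
    · change invol (invol (x k)) = x k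
      simp [invol_x, invol_y]
    · change invol (invol (y k)) = y k
      simp [invol_x, invol_y]
  exact DFunLike.congr_fun this f

theorem ddY_sub (i : ℕ) (f g : Poly) : ddY i (f - g) = ddY i f - ddY i g := by
  simp [ddY, ddX_sub]

/-- The automorphism exchanging `y i` and `y (i + 1)`. -/
def tAct (i : ℕ) : Poly →ₐ[ℤ] Poly :=
  (invol.comp (sAct i)).comp invol

theorem tAct_x (i k : ℕ) : tAct i (x k) = x k := by
  simp [tAct, invol_x, invol_y, sAct_y]

theorem tAct_y (i k : ℕ) : tAct i (y k) = y (Equiv.swap i (i + 1) k) := by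
  simp [tAct, invol_x, invol_y, sAct_x]

/-- The denominator is reversed because the involution sends `x i - x (i + 1)` to `y (i + 1) - y i`.
-/
theorem ddY_spec (i : ℕ) (f : Poly) : f - tAct i f = (y (i + 1) - y i) * ddY i f := by
  have h1 := congrArg invol (ddX_spec i (invol f))
  rw [map_sub, invol_invol, map_mul, map_sub, invol_x, invol_x] at h1
  rw [show f - tAct i f = _ from h1, ddY]; ring

theorem y_sub_ne_zero {i j : ℕ} (hij : i ≠ j) : y i - y j ≠ 0 := by
  rw [sub_ne_zero]
  intro e
  exact hij (Sum.inr_injective (X_injective e))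

theorem ddY_eq_zero_iff {i : ℕ} {f : Poly} : ddY i f = 0 ↔ tAct i f = f := by
  have := ddY_spec i f
  constructor
  · intro e
    rw [e, mul_zero, sub_eq_zero] at this
    exact this.symm
  · intro e
    rw [e, sub_self] at this
    exact (mul_eq_zero.1 this.symm).resolve_left (y_sub_ne_zero (by omega))

theorem sAct_tAct (i j : ℕ) (f : Poly) : sAct i (tAct j f) = tAct j (sAct i f) := by
  have : (sAct i).comp (tAct j) = (tAct j).comp (sAct i) := by
    apply algHom_ext_xy <;> intro k
    · change sAct i (tAct j (x k)) = tAct j (sAct i (x k))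
      simp only [sAct_x, tAct_x]
    · change sAct i (tAct j (y k)) = tAct j (sAct i (y k))
      simp only [sAct_y, tAct_y]
  exact DFunLike.congr_fun this f

/-- The two transpositions act on disjoint alphabets, so they commute and each fixes the other's
denominator. -/
theorem ddX_ddY (i j : ℕ) (f : Poly) : ddX i (ddY j f) = ddY j (ddX i f) := by
  have e1 := ddY_spec j f
  have e2 := congrArg (sAct i) e1
  have e3 := ddX_spec i f
  have e4 := congrArg (tAct j) e3
  rw [map_sub, map_mul, map_sub, sAct_y, sAct_y] at e2
  rw [map_sub, map_mul, map_sub, tAct_x, tAct_x] at e4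
  have e5 := ddX_spec i (ddY j f)
  have e6 := ddY_spec j (ddX i f)
  have e7 := sAct_tAct i j f
  apply mul_left_cancel₀ (x_sub_ne_zero (show i ≠ i + 1 by omega))
  apply mul_left_cancel₀ (y_sub_ne_zero (show j + 1 ≠ j by omega))
  linear_combination (-(y (j + 1) - y j)) * e5 + (x i - x (i + 1)) * e6 + (-e1 + e2 + e3 - e4 + e7)

/-! ### Length, inversions and codes -/

/-- The inversions of a permutation. -/
def invSet (w : SInf) : Set (ℕ × ℕ) :=
  {p | p.1 < p.2 ∧ w.1 p.2 < w.1 p.1}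

theorem mul_val (v w : SInf) (k : ℕ) : (v * w).1 k = v.1 (w.1 k) := rfl

theorem inv_val_apply (w : SInf) (k : ℕ) : (w⁻¹).1 (w.1 k) = k :=
  Equiv.symm_apply_apply w.1 k

theorem apply_inv_val (w : SInf) (k : ℕ) : w.1 ((w⁻¹).1 k) = k :=
  Equiv.apply_symm_apply w.1 k

theorem s_val (i k : ℕ) : (s i).1 k = Equiv.swap i (i + 1) k := rfl

theorem s_mul_s (i : ℕ) : s i * s i = 1 := by
  apply Subtype.ext
  ext k
  change Equiv.swap i (i + 1) (Equiv.swap i (i + 1) k) = k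
  simp

theorem mul_s_mul_s (w : SInf) (i : ℕ) : w * s i * s i = w := by
  rw [mul_assoc, s_mul_s, mul_one]

theorem s_inv (i : ℕ) : (s i)⁻¹ = s i := inv_eq_of_mul_eq_one_left (s_mul_s i)

theorem s_apply_left (i : ℕ) : (s i).1 i = i + 1 := Equiv.swap_apply_left _ _

theorem s_apply_right (i : ℕ) : (s i).1 (i + 1) = i := Equiv.swap_apply_right _ _

theorem s_apply_of_ne {i k : ℕ} (h1 : k ≠ i) (h2 : k ≠ i + 1) : (s i).1 k = k :=
  Equiv.swap_apply_of_ne_of_ne h1 h2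

theorem sinf_ext {v w : SInf} (e : ∀ k, v.1 k = w.1 k) : v = w :=
  Subtype.ext (Equiv.ext e)

/-- The permutation lies in `S_n`. -/
def Fixes (n : ℕ) (w : SInf) : Prop := ∀ i, n ≤ i → w.1 i = i

theorem exists_fixes (w : SInf) : ∃ n, Fixes n w := w.2

theorem Fixes.mono {m n : ℕ} {w : SInf} (hw : Fixes m w) (hmn : m ≤ n) : Fixes n w :=
  fun i hi => hw i (hmn.trans hi)

theorem Fixes.lt {n : ℕ} {w : SInf} (hw : Fixes n w) {i : ℕ} (hi : i < n) : w.1 i < n := by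
  by_contra! hc
  have := w.1.injective (hw _ hc)
  omega

theorem Fixes.mul {n : ℕ} {v w : SInf} (hv : Fixes n v) (hw : Fixes n w) : Fixes n (v * w) := by
  intro i hi
  rw [mul_val, hw i hi, hv i hi]

theorem Fixes.inverse {n : ℕ} {w : SInf} (hw : Fixes n w) : Fixes n w⁻¹ := by
  intro i hi
  conv_lhs => rw [← hw i hi]
  exact inv_val_apply w i

theorem fixes_s {n i : ℕ} (hi : i + 1 < n) : Fixes n (s i) :=
  fun k hk => s_apply_of_ne (by omega) (by omega)

theorem fixes_one (n : ℕ) : Fixes n 1 := fun _ _ => rfl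

theorem Fixes.lt_of_lt_of_inv {n : ℕ} {w : SInf} (hw : Fixes n w) {i j : ℕ} (hij : i < j)
    (e : w.1 j < w.1 i) : j < n := by
  by_contra! hc
  rw [hw j hc] at e
  by_cases hi : i < n
  · have := hw.lt hi; omega
  · rw [hw i (by omega)] at e; omega

theorem Fixes.invSet_subset {n : ℕ} {w : SInf} (hw : Fixes n w) :
    invSet w ⊆ ↑(Finset.range n ×ˢ Finset.range n) := by
  rintro ⟨i, j⟩ ⟨h1, h2⟩
  have := hw.lt_of_lt_of_inv h1 h2
  simp only [Finset.coe_product, Finset.coe_range, Set.mem_prod, Set.mem_Iio] at *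
  omega

theorem invSet_finite (w : SInf) : (invSet w).Finite := by
  obtain ⟨n, hn⟩ := exists_fixes w
  exact (Finset.finite_toSet _).subset hn.invSet_subset

/-- The number of inversions. -/
def inv (w : SInf) : ℕ := (invSet w).ncard

theorem Fixes.inv_le {n : ℕ} {w : SInf} (hw : Fixes n w) : inv w ≤ n * n := by
  have := Set.ncard_le_ncard hw.invSet_subset (Finset.finite_toSet _)
  rwa [Set.ncard_coe_finset, Finset.card_product, Finset.card_range] at this

theorem codeSet_finite (w : SInf) (i : ℕ) : {j : ℕ | i < j ∧ w.1 j < w.1 i}.Finite := by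
  obtain ⟨n, hn⟩ := exists_fixes w
  exact (Set.finite_Iio n).subset fun j hj => hn.lt_of_lt_of_inv hj.1 hj.2

theorem Fixes.code_eq_zero {n : ℕ} {w : SInf} (hw : Fixes n w) {i : ℕ} (hi : n ≤ i) :
    code w i = 0 := by
  rw [code, Set.ncard_eq_zero (codeSet_finite w i)]
  ext j
  simp only [Set.mem_ofPred_eq, Set.mem_empty_iff_false, iff_false]
  rintro ⟨h1, h2⟩
  have := hw.lt_of_lt_of_inv h1 h2
  omega

theorem Fixes.code_add_lt {n : ℕ} {w : SInf} (hw : Fixes n w) {i : ℕ} (hi : i < n) :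
    code w i + i < n := by
  have h1 : {j : ℕ | i < j ∧ w.1 j < w.1 i} ⊆ ↑(Finset.Ioo i n) := by
    rintro j ⟨h1, h2⟩
    have := hw.lt_of_lt_of_inv h1 h2
    simp only [Finset.coe_Ioo, Set.mem_Ioo]
    omega
  have := Set.ncard_le_ncard h1 (Finset.finite_toSet _)
  rw [Set.ncard_coe_finset, Nat.card_Ioo] at this
  change code w i ≤ _ at this
  omega

theorem inv_eq_sum_code {n : ℕ} {w : SInf} (hw : Fixes n w) :
    inv w = ∑ i ∈ Finset.range n, code w i := by
  classical
  have e : invSet w = (fun p : (_ : ℕ) × ℕ => (p.1, p.2)) '' (((Finset.range n).sigma fun i =>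
      (codeSet_finite w i).toFinset : Finset ((_ : ℕ) × ℕ)) : Set ((_ : ℕ) × ℕ)) := by
    ext ⟨i, j⟩
    simp only [invSet, Set.mem_ofPred_eq, Set.mem_image, Finset.mem_coe, Finset.mem_sigma,
      Finset.mem_range, Set.Finite.mem_toFinset, Prod.mk.injEq, Sigma.exists]
    constructor
    · rintro ⟨h1, h2⟩
      have := hw.lt_of_lt_of_inv h1 h2
      exact ⟨i, j, ⟨by omega, h1, h2⟩, rfl, rfl⟩
    · rintro ⟨a, b, ⟨h0, h1, h2⟩, rfl, rfl⟩
      exact ⟨h1, h2⟩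
  rw [inv, e, Set.ncard_image_of_injective, Set.ncard_coe_finset, Finset.card_sigma]
  · apply Finset.sum_congr rfl
    intro i _
    rw [code, Set.ncard_eq_toFinset_card _ (codeSet_finite w i)]
  · rintro ⟨a, b⟩ ⟨c, d⟩ e
    simp only [Prod.mk.injEq] at e
    obtain ⟨rfl, rfl⟩ := e
    rfl

/-- Applying `s i` to both positions matches the inversions of `w` with those of `w * s i` other
than the new one `(i, i + 1)`. -/
theorem inv_mul_s_of_lt {w : SInf} {i : ℕ} (hi : w.1 i < w.1 (i + 1)) :
    inv (w * s i) = inv w + 1 := by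
  have e : invSet (w * s i) =
      insert (i, i + 1) ((fun p : ℕ × ℕ => ((s i).1 p.1, (s i).1 p.2)) '' invSet w) := by
    ext ⟨a, b⟩
    simp only [invSet, Set.mem_ofPred_eq, Set.mem_insert_iff, Prod.mk.injEq, Set.mem_image,
      Prod.exists, mul_val]
    constructor
    · rintro ⟨h1, h2⟩
      by_cases h3 : a = i ∧ b = i + 1
      · exact .inl h3
      · refine .inr ⟨(s i).1 a, (s i).1 b, ⟨?_, h2⟩, ?_, ?_⟩
        · simp only [s_val, Equiv.swap_apply_def]
          split_ifs <;> omega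
        · simp [s_val]
        · simp [s_val]
    · rintro (⟨rfl, rfl⟩ | ⟨a', b', ⟨h1, h2⟩, rfl, rfl⟩)
      · rw [s_apply_left, s_apply_right]
        exact ⟨by omega, hi⟩
      · have h3 : ¬ (a' = i ∧ b' = i + 1) := by
          rintro ⟨rfl, rfl⟩; omega
        have e1 : ∀ c, (s i).1 ((s i).1 c) = c := fun c => by simp [s_val]
        rw [e1, e1]
        refine ⟨?_, h2⟩
        simp only [s_val, Equiv.swap_apply_def]
        split_ifs <;> omega
  rw [inv, e, Set.ncard_insert_of_notMem _ ((invSet_finite w).image _),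
    Set.ncard_image_of_injective, inv]
  · rintro ⟨a, b⟩ ⟨c, d⟩ e
    simp only [Prod.mk.injEq, EmbeddingLike.apply_eq_iff_eq] at e
    exact Prod.ext e.1 e.2
  · simp only [Set.mem_image, Prod.mk.injEq, Prod.exists, not_exists, not_and]
    intro a b hab e1 e2
    have e3 : a = i + 1 := (s i).1.injective (e1.trans (s_apply_right i).symm)
    have e4 : b = i := (s i).1.injective (e2.trans (s_apply_left i).symm)
    have := hab.1
    simp only at this
    omega

theorem apply_ne_succ (w : SInf) (i : ℕ) : w.1 i ≠ w.1 (i + 1) := by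
  intro e
  have := w.1.injective e
  omega

theorem inv_mul_s_of_gt {w : SInf} {i : ℕ} (hi : w.1 (i + 1) < w.1 i) :
    inv (w * s i) + 1 = inv w := by
  have h1 : (w * s i).1 i < (w * s i).1 (i + 1) := by
    rwa [mul_val, mul_val, s_apply_left, s_apply_right]
  have h2 := inv_mul_s_of_lt h1
  rw [mul_s_mul_s] at h2
  exact h2.symm

theorem inv_mul_s_lt_iff (w : SInf) (i : ℕ) : inv (w * s i) < inv w ↔ w.1 (i + 1) < w.1 i := by
  rcases lt_or_gt_of_ne (apply_ne_succ w i) with e | e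
  · rw [inv_mul_s_of_lt e]; omega
  · have := inv_mul_s_of_gt e; omega

theorem inv_inv (w : SInf) : inv w⁻¹ = inv w := by
  have e : invSet w = (fun p : ℕ × ℕ => ((w⁻¹).1 p.2, (w⁻¹).1 p.1)) '' invSet w⁻¹ := by
    ext ⟨a, b⟩
    simp only [invSet, Set.mem_ofPred_eq, Set.mem_image, Prod.mk.injEq, Prod.exists]
    constructor
    · rintro ⟨h1, h2⟩
      refine ⟨w.1 b, w.1 a, ⟨h2, ?_⟩, ?_, ?_⟩ <;> simp only [inv_val_apply]
      exact h1
    · rintro ⟨c, d, ⟨h1, h2⟩, rfl, rfl⟩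
      simp only [apply_inv_val]
      exact ⟨h2, h1⟩
  rw [inv, inv, e, Set.ncard_image_of_injective]
  rintro ⟨a, b⟩ ⟨c, d⟩ e
  simp only [Prod.mk.injEq, EmbeddingLike.apply_eq_iff_eq] at e
  exact Prod.ext e.2 e.1

theorem inv_one : inv 1 = 0 := by
  rw [inv_eq_sum_code (fixes_one 0)]; rfl

/-- An increasing bijection and its inverse both dominate the identity. -/
theorem eq_one_of_no_descent {w : SInf} (hw : ∀ i, w.1 i < w.1 (i + 1)) : w = 1 := by
  have h1 : StrictMono w.1 := strictMono_nat_of_lt_succ hw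
  have h2 : StrictMono (w⁻¹).1 := by
    intro a b hab
    rw [← h1.lt_iff_lt, apply_inv_val, apply_inv_val]
    exact hab
  apply sinf_ext
  intro k
  change w.1 k = k
  have h3 := h1.le_apply (x := k)
  have h4 := h2.le_apply (x := w.1 k)
  rw [inv_val_apply] at h4
  omega

theorem exists_descent {w : SInf} (hw : w ≠ 1) : ∃ i, w.1 (i + 1) < w.1 i := by
  by_contra! hc
  exact hw (eq_one_of_no_descent fun i => lt_of_le_of_ne (hc i) (apply_ne_succ w i))

theorem exists_word (w : SInf) : ∃ l : List ℕ, l.length = inv w ∧ (l.map s).prod = w := by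
  induction hd : inv w generalizing w with
  | zero =>
    refine ⟨[], rfl, ?_⟩
    by_contra hw
    obtain ⟨i, hi⟩ := exists_descent (Ne.symm hw)
    have := inv_mul_s_of_gt hi
    omega
  | succ d ih =>
    have hw : w ≠ 1 := by
      rintro rfl
      rw [inv_one] at hd; omega
    obtain ⟨i, hi⟩ := exists_descent hw
    have := inv_mul_s_of_gt hi
    obtain ⟨l, h1, h2⟩ := ih (w * s i) (by omega)
    refine ⟨l ++ [i], by simp [h1], ?_⟩
    rw [List.map_append, List.prod_append, h2]
    simp [mul_s_mul_s]

theorem inv_word_le (l : List ℕ) : inv (l.map s).prod ≤ l.length := by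
  induction l using List.reverseRecOn with
  | nil => simp [inv_one]
  | append_singleton l i ih =>
    rw [List.map_append, List.prod_append]
    simp only [List.map_cons, List.map_nil, List.prod_cons, List.prod_nil, mul_one,
      List.length_append, List.length_cons, List.length_nil]
    rcases lt_or_gt_of_ne (apply_ne_succ (l.map s).prod i) with e | e
    · rw [inv_mul_s_of_lt e]; omega
    · have := inv_mul_s_of_gt e; omega

/-- Sorting along descents gives a word with as many letters as inversions; conversely each letter
changes the number of inversions by one. -/
theorem length_eq_inv (w : SInf) : length w = inv w := by
  obtain ⟨l, h1, h2⟩ := exists_word w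
  apply le_antisymm
  · exact Nat.sInf_le ⟨l, h1, h2⟩
  · obtain ⟨l', h3, h4⟩ := Nat.sInf_mem (s := {r | ∃ l : List ℕ, l.length = r ∧ (l.map s).prod = w})
      ⟨_, l, h1, h2⟩
    rw [length, ← h3]
    conv_lhs => rw [← h4]
    exact inv_word_le l'

theorem length_mul_s_lt_iff (w : SInf) (i : ℕ) :
    length (w * s i) < length w ↔ w.1 (i + 1) < w.1 i := by
  rw [length_eq_inv, length_eq_inv, inv_mul_s_lt_iff]

theorem inv_s_mul (w : SInf) (i : ℕ) : inv (s i * w) = inv (w⁻¹ * s i) := by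
  rw [← inv_inv, mul_inv_rev, s_inv]

theorem length_s_mul_lt_iff (w : SInf) (i : ℕ) :
    length (s i * w) < length w ↔ inv (s i * w) < inv w := by
  rw [length_eq_inv, length_eq_inv]

theorem inv_s_mul_cases (w : SInf) (i : ℕ) :
    inv (s i * w) = inv w + 1 ∨ inv (s i * w) + 1 = inv w := by
  rw [inv_s_mul, ← inv_inv w]
  rcases lt_or_gt_of_ne (apply_ne_succ w⁻¹ i) with e | e
  · exact .inl (inv_mul_s_of_lt e)
  · exact .inr (inv_mul_s_of_gt e)

theorem inv_mul_s_cases (w : SInf) (i : ℕ) :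
    inv (w * s i) = inv w + 1 ∨ inv (w * s i) + 1 = inv w := by
  rcases lt_or_gt_of_ne (apply_ne_succ w i) with e | e
  · exact .inl (inv_mul_s_of_lt e)
  · exact .inr (inv_mul_s_of_gt e)

theorem lt_iff_inv_mul_s (w : SInf) (i : ℕ) : w.1 i < w.1 (i + 1) ↔ inv w < inv (w * s i) := by
  have := inv_mul_s_lt_iff w i
  have := inv_mul_s_cases w i
  have := apply_ne_succ w i
  omega

/-! ### Codes under right multiplication by a simple transposition -/

theorem code_mul_s_of_ne (w : SInf) {i k : ℕ} (h1 : k ≠ i) (h2 : k ≠ i + 1) :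
    code (w * s i) k = code w k := by
  have e : {j : ℕ | k < j ∧ w.1 j < w.1 k} =
      (s i).1 '' {j : ℕ | k < j ∧ (w * s i).1 j < (w * s i).1 k} := by
    ext j
    simp only [Set.mem_ofPred_eq, Set.mem_image, mul_val, s_apply_of_ne h1 h2]
    have e1 : ∀ c, (s i).1 ((s i).1 c) = c := fun c => by simp [s_val]
    constructor
    · rintro ⟨h3, h4⟩
      refine ⟨(s i).1 j, ⟨?_, ?_⟩, e1 j⟩
      · simp only [s_val, Equiv.swap_apply_def]
        split_ifs <;> omega
      · rwa [e1]
    · rintro ⟨j, ⟨h3, h4⟩, rfl⟩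
      refine ⟨?_, h4⟩
      simp only [s_val, Equiv.swap_apply_def]
      split_ifs <;> omega
  rw [code, code, e, Set.ncard_image_of_injective _ (s i).1.injective]

/-- Turning an ascent at `i` into a descent exchanges the two code entries, and the one moved to the
left gains one for the new inversion. -/
theorem code_mul_s_left {w : SInf} {i : ℕ} (hi : w.1 i < w.1 (i + 1)) :
    code (w * s i) i = code w (i + 1) + 1 := by
  have e : {j : ℕ | i < j ∧ (w * s i).1 j < (w * s i).1 i} =
      insert (i + 1) {j : ℕ | i + 1 < j ∧ w.1 j < w.1 (i + 1)} := by
    ext j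
    simp only [Set.mem_ofPred_eq, Set.mem_insert_iff, mul_val, s_apply_left]
    by_cases hj : j = i + 1
    · subst hj
      rw [s_apply_right]
      simpa using hi
    · constructor
      · rintro ⟨h1, h2⟩
        rw [s_apply_of_ne (by omega) hj] at h2
        exact .inr ⟨by omega, h2⟩
      · rintro (h1 | ⟨h1, h2⟩)
        · exact absurd h1 hj
        · rw [s_apply_of_ne (by omega) hj]
          exact ⟨by omega, h2⟩
  rw [code, e, Set.ncard_insert_of_notMem (by simp) (codeSet_finite w (i + 1)), code]

theorem code_mul_s_right {w : SInf} {i : ℕ} (hi : w.1 i < w.1 (i + 1)) :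
    code (w * s i) (i + 1) = code w i := by
  rw [code, code]
  congr 1
  ext j
  simp only [Set.mem_ofPred_eq, mul_val, s_apply_right]
  by_cases hj : j = i + 1
  · subst hj; omega
  · constructor
    · rintro ⟨h1, h2⟩
      rw [s_apply_of_ne (by omega) hj] at h2
      exact ⟨by omega, h2⟩
    · rintro ⟨h1, h2⟩
      rw [s_apply_of_ne (by omega) hj]
      exact ⟨by omega, h2⟩

theorem code_succ_lt_code {w : SInf} {i : ℕ} (hi : w.1 (i + 1) < w.1 i) :
    code w (i + 1) < code w i := by
  have hs : {j : ℕ | i + 1 < j ∧ w.1 j < w.1 (i + 1)} ⊂ {j : ℕ | i < j ∧ w.1 j < w.1 i} := by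
    rw [Set.ssubset_iff_of_subset]
    · exact ⟨i + 1, ⟨by omega, hi⟩, by simp⟩
    · rintro j ⟨h4, h5⟩
      exact ⟨by omega, by omega⟩
  exact Set.ncard_lt_ncard hs (codeSet_finite w i)

theorem code_le_code_succ {w : SInf} {i : ℕ} (hi : w.1 i < w.1 (i + 1)) :
    code w i ≤ code w (i + 1) := by
  apply Set.ncard_le_ncard _ (codeSet_finite w (i + 1))
  rintro j ⟨h1, h2⟩
  have : j ≠ i + 1 := by rintro rfl; omega
  exact ⟨by omega, by omega⟩

theorem lt_succ_iff_code (w : SInf) (i : ℕ) :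
    w.1 i < w.1 (i + 1) ↔ code w i ≤ code w (i + 1) := by
  refine ⟨code_le_code_succ, fun e => ?_⟩
  by_contra hc
  have := code_succ_lt_code (lt_of_le_of_ne (not_lt.1 hc) (apply_ne_succ w i).symm)
  omega

/-! ### Products over diagrams -/

/-- The product of the factors `x i - y j` over the cells of a diagram with rows `c i`, `i < n`. -/
def prodDiagram (n : ℕ) (c : ℕ → ℕ) : Poly :=
  ∏ i ∈ Finset.range n, ∏ j ∈ Finset.range (c i), (x i - y j)

/-- The top polynomial in `n` variables of each kind. -/
def base (n : ℕ) : Poly := prodDiagram n fun i => n - 1 - i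

theorem prodDiagram_congr {n : ℕ} {c d : ℕ → ℕ} (e : ∀ i < n, c i = d i) :
    prodDiagram n c = prodDiagram n d :=
  Finset.prod_congr rfl fun i hi => by rw [e i (Finset.mem_range.1 hi)]

theorem sAct_prodDiagram {n r : ℕ} {c : ℕ → ℕ} (hr : r + 1 < n) (hc : c r = c (r + 1)) :
    sAct r (prodDiagram n c) = prodDiagram n c := by
  simp only [prodDiagram, map_prod, map_sub, sAct_x, sAct_y]
  refine Finset.prod_bij' (fun i _ => Equiv.swap r (r + 1) i) (fun i _ => Equiv.swap r (r + 1) i)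
    ?_ ?_ ?_ ?_ ?_
  · intro i hi
    simp only [Finset.mem_range, Equiv.swap_apply_def] at *
    split_ifs <;> omega
  · intro i hi
    simp only [Finset.mem_range, Equiv.swap_apply_def] at *
    split_ifs <;> omega
  · simp
  · simp
  · intro i _
    have : c (Equiv.swap r (r + 1) i) = c i := by
      simp only [Equiv.swap_apply_def]
      split_ifs with h1 h2
      · rw [h1, hc]
      · rw [h2, hc]
      · rfl
    rw [this]

theorem prodDiagram_add_cell {n r : ℕ} {c d : ℕ → ℕ} (hr : r < n) (hd : d r = c r + 1)
    (hcd : ∀ i, i ≠ r → d i = c i) :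
    prodDiagram n d = (x r - y (c r)) * prodDiagram n c := by
  rw [prodDiagram, prodDiagram, ← Finset.mul_prod_erase _ _ (Finset.mem_range.2 hr),
    ← Finset.mul_prod_erase (Finset.range n) _ (Finset.mem_range.2 hr), hd, Finset.prod_range_succ]
  have : ∏ i ∈ (Finset.range n).erase r, ∏ j ∈ Finset.range (d i), (x i - y j) =
      ∏ i ∈ (Finset.range n).erase r, ∏ j ∈ Finset.range (c i), (x i - y j) :=
    Finset.prod_congr rfl fun i hi => by rw [hcd i (Finset.ne_of_mem_erase hi)]
  rw [this]; ring

theorem ddX_prodDiagram {n r : ℕ} {c d : ℕ → ℕ} (hr : r + 1 < n) (hc : c r = c (r + 1))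
    (hd : d r = c r + 1) (hcd : ∀ i, i ≠ r → d i = c i) :
    ddX r (prodDiagram n d) = prodDiagram n c := by
  rw [prodDiagram_add_cell (by omega) hd hcd, ddX_mul_fixed (sAct_prodDiagram hr hc),
    ddX_x_sub_y, one_mul]

theorem invol_base (n : ℕ) : invol (base n) = base n := by
  simp only [base, prodDiagram, map_prod, map_sub, invol_x, invol_y]
  rw [Finset.prod_comm' (t' := Finset.range n) (s' := fun j => Finset.range (n - 1 - j))]
  · refine Finset.prod_congr rfl fun i _ => Finset.prod_congr rfl fun j _ => ?_
    ring
  · intro i j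
    simp only [Finset.mem_range]
    omega

/-- Deleting the last cell of row `r` makes rows `r` and `r + 1` equally long, so the remaining
product is invariant under `sAct r` and is the divided difference. -/
theorem base_eq_mul_ddX {n r : ℕ} (hr : r + 1 < n) :
    base n = (x r - y (n - 2 - r)) * ddX r (base n) := by
  have h1 : ∀ i, i ≠ r → n - 1 - i = Function.update (fun i => n - 1 - i) r (n - 2 - r) i := by
    intro i hi
    rw [Function.update_of_ne hi]
  have h2 : n - 1 - r = Function.update (fun i => n - 1 - i) r (n - 2 - r) r + 1 := by
    rw [Function.update_self]; omega
  have h3 : Function.update (fun i => n - 1 - i) r (n - 2 - r) r =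
      Function.update (fun i => n - 1 - i) r (n - 2 - r) (r + 1) := by
    rw [Function.update_self, Function.update_of_ne (by omega)]; omega
  rw [base, ddX_prodDiagram hr h3 h2 h1, prodDiagram_add_cell (by omega) h2 h1,
    Function.update_self]

/-- The involution transposes the staircase: it turns the factorization at row `r` into one with the
linear factor of row `n - 2 - r`, which is then cancelled. -/
theorem ddY_base {n r : ℕ} (hr : r + 1 < n) : ddY r (base n) = ddX (n - 2 - r) (base n) := by
  have h1 := base_eq_mul_ddX hr
  have h2 := congrArg invol h1
  rw [map_mul, map_sub, invol_x, invol_y, invol_base] at h2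
  have h3 := base_eq_mul_ddX (n := n) (r := n - 2 - r) (by omega)
  rw [show n - 2 - (n - 2 - r) = r by omega] at h3
  rw [ddY, invol_base]
  apply mul_left_cancel₀ (x_sub_y_ne_zero (n - 2 - r) r)
  rw [← h3]
  conv_rhs => rw [h2]
  ring

/-! ### The Schubert polynomials of a finite symmetric group -/

/-- The recursion that defines the double Schubert polynomials of `S_n`, descending from the
longest element. -/
structure IsFam (n : ℕ) (T : SInf → Poly) : Prop where
  top : ∀ w, Fixes n w → (∀ i, i + 1 < n → w.1 (i + 1) < w.1 i) → T w = base n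
  step : ∀ w, Fixes n w → ∀ i, i + 1 < n → w.1 i < w.1 (i + 1) → ddX i (T (w * s i)) = T w

open Classical in
/-- Applies divided differences to the top polynomial along ascents of `w`, at most `d` times. -/
def famAux (n : ℕ) : ℕ → SInf → Poly
  | 0, _ => base n
  | d + 1, w =>
    if e : ∃ i, i + 1 < n ∧ w.1 i < w.1 (i + 1) then
      ddX e.choose (famAux n d (w * s e.choose))
    else base n

/-- The double Schubert polynomials of `S_n`. -/
def fam (n : ℕ) (w : SInf) : Poly := famAux n (n * n - inv w) w

theorem fam_top {n : ℕ} {w : SInf} (e : ¬ ∃ i, i + 1 < n ∧ w.1 i < w.1 (i + 1)) :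
    fam n w = base n := by
  unfold fam
  cases n * n - inv w with
  | zero => rfl
  | succ d => rw [famAux, dif_neg e]

theorem exists_fam_step {n : ℕ} {w : SInf} (hw : Fixes n w)
    (e : ∃ i, i + 1 < n ∧ w.1 i < w.1 (i + 1)) :
    ∃ i, i + 1 < n ∧ w.1 i < w.1 (i + 1) ∧ fam n w = ddX i (fam n (w * s i)) := by
  refine ⟨e.choose, e.choose_spec.1, e.choose_spec.2, ?_⟩
  have h1 := inv_mul_s_of_lt e.choose_spec.2
  have h2 := (hw.mul (fixes_s e.choose_spec.1)).inv_le
  -- The bound `n * n` on inversions leaves positive fuel as long as an ascent exists.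
  rw [fam, fam, h1, show n * n - inv w = (n * n - (inv w + 1)) + 1 by omega, famAux, dif_pos e]

theorem s_comm {i j : ℕ} (hij : i + 1 < j) : s i * s j = s j * s i := by
  apply sinf_ext
  intro k
  simp only [mul_val, s_val, Equiv.swap_apply_def]
  split_ifs <;> omega

theorem s_braid (i : ℕ) : s i * s (i + 1) * s i = s (i + 1) * s i * s (i + 1) := by
  apply sinf_ext
  intro k
  simp only [mul_val, s_val, Equiv.swap_apply_def]
  split_ifs <;> omega

/-- Diamond argument: two ascents of `w` have a common upper bound, reached by the commutation
relation when they are far apart and by the braid relation when adjacent. The recursion at longer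
permutations rewrites both sides from there. -/
theorem ddX_confluent {n : ℕ} {T : SInf → Poly} {w : SInf} (hw : Fixes n w)
    (ih : ∀ u, Fixes n u → inv w < inv u → ∀ i, i + 1 < n → u.1 i < u.1 (i + 1) →
      ddX i (T (u * s i)) = T u)
    {i j : ℕ} (hij : i < j) (hj : j + 1 < n) (h1 : w.1 i < w.1 (i + 1))
    (h2 : w.1 j < w.1 (j + 1)) : ddX i (T (w * s i)) = ddX j (T (w * s j)) := by
  have fi : Fixes n (w * s i) := hw.mul (fixes_s (by omega))
  have fj : Fixes n (w * s j) := hw.mul (fixes_s (by omega))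
  have l1 := inv_mul_s_of_lt h1
  have l2 := inv_mul_s_of_lt h2
  by_cases hc : i + 1 < j
  · rw [← ih _ fi (by omega) j hj, ← ih _ fj (by omega) i (by omega), ddX_comm hc, mul_assoc,
      s_comm hc, mul_assoc]
    · rw [mul_val, mul_val, s_apply_of_ne (by omega) (by omega), s_apply_of_ne (by omega) (by omega)]
      exact h1
    · rw [mul_val, mul_val, s_apply_of_ne (by omega) (by omega), s_apply_of_ne (by omega) (by omega)]
      exact h2
  · obtain rfl : j = i + 1 := by omega
    have a1 : (w * s i).1 (i + 1) < (w * s i).1 (i + 2) := by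
      rw [mul_val, mul_val, s_apply_right, s_apply_of_ne (by omega) (by omega)]
      exact h1.trans h2
    have a2 : (w * s i * s (i + 1)).1 i < (w * s i * s (i + 1)).1 (i + 1) := by
      rw [mul_val, mul_val, mul_val, mul_val, s_apply_of_ne (k := i) (by omega) (by omega),
        s_apply_left, s_apply_left, s_apply_of_ne (k := i + 1 + 1) (by omega) (by omega)]
      exact h2
    have b1 : (w * s (i + 1)).1 i < (w * s (i + 1)).1 (i + 1) := by
      rw [mul_val, mul_val, s_apply_left, s_apply_of_ne (by omega) (by omega)]
      exact h1.trans h2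
    have b2 : (w * s (i + 1) * s i).1 (i + 1) < (w * s (i + 1) * s i).1 (i + 2) := by
      rw [mul_val, mul_val, mul_val, mul_val, s_apply_right, s_apply_of_ne (by omega) (by omega),
        s_apply_of_ne (i := i) (by omega) (by omega), s_apply_right]
      exact h1
    have l3 := inv_mul_s_of_lt a1
    have l4 := inv_mul_s_of_lt b1
    rw [← ih _ fi (by omega) (i + 1) hj a1,
      ← ih _ (fi.mul (fixes_s hj)) (by omega) i (by omega) a2,
      ← ih _ fj (by omega) i (by omega) b1,
      ← ih _ (fj.mul (fixes_s (by omega))) (by omega) (i + 1) hj b2, ddX_braid]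
    congr 4
    simp only [mul_assoc]
    rw [← mul_assoc (s i), s_braid, mul_assoc]

theorem isFam_fam (n : ℕ) : IsFam n (fam n) := by
  constructor
  · intro w _ ht
    apply fam_top
    rintro ⟨i, h1, h2⟩
    exact absurd h2 (ht i h1).not_gt
  · intro w
    induction hd : n * n - inv w using Nat.strong_induction_on generalizing w with
    | _ d ih =>
    intro hw i hi hlt
    have ih' : ∀ u, Fixes n u → inv w < inv u → ∀ i, i + 1 < n → u.1 i < u.1 (i + 1) →
        ddX i (fam n (u * s i)) = fam n u := by
      intro u hu hwu
      have := hu.inv_le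
      exact ih (n * n - inv u) (by omega) u rfl hu
    obtain ⟨j, hj, hlt', e⟩ := exists_fam_step hw ⟨i, hi, hlt⟩
    rw [e]
    rcases lt_trichotomy i j with hij | rfl | hij
    · exact ddX_confluent hw ih' hij hj hlt hlt'
    · rfl
    · exact (ddX_confluent hw ih' hij hi hlt' hlt).symm

theorem IsFam.eq_of_isFam {n : ℕ} {T U : SInf → Poly} (hT : IsFam n T) (hU : IsFam n U)
    {w : SInf} (hw : Fixes n w) : T w = U w := by
  induction hd : n * n - inv w using Nat.strong_induction_on generalizing w with
  | _ d ih =>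
  by_cases e : ∃ i, i + 1 < n ∧ w.1 i < w.1 (i + 1)
  · obtain ⟨i, hi, hlt⟩ := e
    have h1 := hw.mul (fixes_s hi)
    have h2 := h1.inv_le
    have h3 := inv_mul_s_of_lt hlt
    rw [← hT.step w hw i hi hlt, ← hU.step w hw i hi hlt, ih _ (by omega) h1 rfl]
  · have e' : ∀ i, i + 1 < n → w.1 (i + 1) < w.1 i := by
      intro i hi
      by_contra hc
      exact e ⟨i, hi, lt_of_le_of_ne (not_lt.1 hc) (apply_ne_succ w i)⟩
    rw [hT.top w hw e', hU.top w hw e']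

theorem le_of_descending {n : ℕ} {f : ℕ → ℕ} (hf : ∀ i, i + 1 < n → f (i + 1) < f i) {d i : ℕ}
    (hi : i + d + 1 = n) : d ≤ f i := by
  induction d generalizing i with
  | zero => omega
  | succ d ih =>
    have := ih (i := i + 1) (by omega)
    have := hf i (by omega)
    omega

theorem code_of_top {n : ℕ} {w : SInf} (hw : Fixes n w)
    (ht : ∀ i, i + 1 < n → w.1 (i + 1) < w.1 i) {i : ℕ} (hi : i < n) : code w i = n - 1 - i := by
  have h1 := hw.code_add_lt hi
  have h2 := le_of_descending (n := n) (f := code w) (fun i hi => code_succ_lt_code (ht i hi))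
    (d := n - 1 - i) (i := i) (by omega)
  omega

theorem val_of_top {n : ℕ} {w : SInf} (hw : Fixes n w)
    (ht : ∀ i, i + 1 < n → w.1 (i + 1) < w.1 i) {i : ℕ} (hi : i < n) : w.1 i = n - 1 - i := by
  have h2 := le_of_descending (n := n) (f := w.1) ht (d := n - 1 - i) (i := i) (by omega)
  have h1 : ∀ i, i < n → w.1 i + i < n := by
    intro i
    induction i with
    | zero => exact fun h => hw.lt h
    | succ i ih =>
      intro h
      have := ih (by omega)
      have := ht i h
      omega
  have := h1 i hi
  omega

/-! ### Dominant permutations -/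

/-- Take the first row shorter than the staircase, then the first `r` from there on with rows `r`
and `r + 1` equal. Such an `r` exists, since rows strictly decreasing from a deficient one would
stay deficient until the last row, where there is no room. Minimality of both choices makes the row
above `r` strictly longer. -/
theorem exists_addable {n : ℕ} {c : ℕ → ℕ} (hc : Antitone c) (hn : ∀ i < n, c i + i < n)
    (hne : ∃ i < n, c i ≠ n - 1 - i) :
    ∃ r, r + 1 < n ∧ c r = c (r + 1) ∧ ∀ q, q + 1 = r → c r < c q := by
  classical
  have hex : ∃ i, i < n ∧ c i + i + 1 < n := by
    obtain ⟨i, hi, h1⟩ := hne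
    have := hn i hi
    exact ⟨i, hi, by omega⟩
  set r₀ := Nat.find hex with hr₀
  have h0 : r₀ < n ∧ c r₀ + r₀ + 1 < n := Nat.find_spec hex
  have hex' : ∃ r, r₀ ≤ r ∧ r + 1 < n ∧ c r = c (r + 1) := by
    by_contra! hcon
    have h1 : ∀ d, r₀ + d < n → c (r₀ + d) + (r₀ + d) + 1 < n := by
      intro d
      induction d with
      | zero => exact fun _ => h0.2
      | succ d ih =>
        intro hd
        have := ih (by omega)
        have := hcon (r₀ + d) (by omega) (by omega)
        have := hc (show r₀ + d ≤ r₀ + d + 1 by omega)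
        rw [← add_assoc r₀ d 1]
        omega
    have := h1 (n - 1 - r₀) (by omega)
    omega
  obtain ⟨h1, h2, h3⟩ := Nat.find_spec hex'
  refine ⟨Nat.find hex', h2, h3, fun q hq => ?_⟩
  rcases lt_or_ge q r₀ with h4 | h4
  · have h5 := Nat.find_min hex h4
    have h6 : Nat.find hex' = r₀ := by omega
    rw [h6] at hq ⊢
    omega
  · have h5 := Nat.find_min hex' (m := q) (by omega)
    rw [hq] at h5
    have := hc (show q ≤ Nat.find hex' by omega)
    omega

/-- Downward induction on length: adding a cell at row `r` corresponds to passing to `v * s r`,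
again dominant, and the divided difference removes exactly the factor of that cell. -/
theorem IsFam.dominant {n : ℕ} {T : SInf → Poly} (hT : IsFam n T) {v : SInf} (hv : Fixes n v)
    (hd : IsDominant v) : T v = prodDiagram n (code v) := by
  induction hm : n * n - inv v using Nat.strong_induction_on generalizing v with
  | _ m ih =>
  by_cases hne : ∃ i < n, code v i ≠ n - 1 - i
  · obtain ⟨r, hr, h1, h2⟩ := exists_addable hd (fun i hi => hv.code_add_lt hi) hne
    have hlt := (lt_succ_iff_code v r).2 h1.le
    have c1 := code_mul_s_left hlt
    have c2 := code_mul_s_right hlt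
    have hv' := hv.mul (fixes_s hr)
    have l1 := inv_mul_s_of_lt hlt
    have l2 := hv'.inv_le
    have hcd : ∀ i, i ≠ r → code (v * s r) i = code v i := by
      intro i hi
      by_cases hi' : i = r + 1
      · rw [hi', c2, h1]
      · exact code_mul_s_of_ne v hi hi'
    have hd' : IsDominant (v * s r) := by
      apply antitone_nat_of_succ_le
      intro k
      have h3 := hd (show k ≤ k + 1 by omega)
      by_cases k1 : k = r
      · subst k1; omega
      · by_cases k2 : k + 1 = r
        · have := h2 k k2
          rw [hcd k k1, k2]; omega
        · rw [hcd k k1, hcd (k + 1) k2]; exact h3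
    rw [← hT.step v hv r hr hlt, ih _ (by omega) hv' hd' rfl]
    exact ddX_prodDiagram hr h1 (by omega) hcd
  · push Not at hne
    rw [hT.top v hv, base]
    · exact prodDiagram_congr fun i hi => (hne i hi).symm
    · intro i hi
      have h1 := hne i (by omega)
      have h2 := hne (i + 1) hi
      by_contra hc
      have := (lt_succ_iff_code v i).1 (lt_of_le_of_ne (not_lt.1 hc) (apply_ne_succ v i))
      omega

/-- The longest element of `S_n` is dominant with staircase code, so its polynomial in the larger
family is `base n`. -/
theorem IsFam.of_succ {n : ℕ} {T : SInf → Poly} (hT : IsFam (n + 1) T) : IsFam n T := by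
  constructor
  · intro w hw ht
    have hd : IsDominant w := by
      apply antitone_nat_of_succ_le
      intro k
      rcases lt_or_ge (k + 1) n with hk | hk
      · rw [code_of_top hw ht hk, code_of_top hw ht (by omega)]; omega
      · rw [hw.code_eq_zero hk]; omega
    rw [hT.dominant (hw.mono (by omega)) hd, prodDiagram, Finset.prod_range_succ,
      hw.code_eq_zero le_rfl, Finset.range_zero, Finset.prod_empty, mul_one]
    exact prodDiagram_congr fun i hi => code_of_top hw ht hi
  · intro w hw i hi
    exact hT.step w (hw.mono (by omega)) i (by omega)

theorem IsFam.of_le {m n : ℕ} (hmn : m ≤ n) {T : SInf → Poly} (hT : IsFam n T) : IsFam m T := by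
  induction n, hmn using Nat.le_induction with
  | base => exact hT
  | succ n _ ih => exact ih hT.of_succ

/-! ### The family of double Schubert polynomials -/

theorem fixes_rank (w : SInf) : Fixes (rank w) w :=
  Nat.sInf_mem (s := {n | ∀ i, n ≤ i → w.1 i = i}) (exists_fixes w)

theorem rank_le {n : ℕ} {w : SInf} (hw : Fixes n w) : rank w ≤ n := Nat.sInf_le hw

/-- The double Schubert polynomials. -/
def schubert (w : SInf) : Poly := fam (rank w) w

theorem schubert_eq_fam {n : ℕ} {w : SInf} (hw : Fixes n w) : schubert w = fam n w :=
  (isFam_fam (rank w)).eq_of_isFam ((isFam_fam n).of_le (rank_le hw)) (fixes_rank w)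

theorem isFam_schubert (n : ℕ) : IsFam n schubert := by
  constructor
  · intro w hw ht
    rw [schubert_eq_fam hw, (isFam_fam n).top w hw ht]
  · intro w hw i hi hlt
    rw [schubert_eq_fam hw, schubert_eq_fam (hw.mul (fixes_s hi)), (isFam_fam n).step w hw i hi hlt]

theorem IsFam.ddX_of_descent {n : ℕ} {T : SInf → Poly} (hT : IsFam n T) {w : SInf}
    (hw : Fixes n w) {i : ℕ} (hi : i + 1 < n) (hlt : w.1 (i + 1) < w.1 i) :
    ddX i (T w) = T (w * s i) := by
  have h1 := hT.step (w * s i) (hw.mul (fixes_s hi)) i hi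
    (by rwa [mul_val, mul_val, s_apply_left, s_apply_right])
  rwa [mul_s_mul_s] at h1

theorem IsFam.ddX_of_ascent {n : ℕ} {T : SInf → Poly} (hT : IsFam n T) {w : SInf}
    (hw : Fixes n w) {i : ℕ} (hi : i + 1 < n) (hlt : w.1 i < w.1 (i + 1)) :
    ddX i (T w) = 0 := by
  rw [← hT.step w hw i hi hlt, ddX_ddX_self]

theorem s_mul_top {n : ℕ} {w : SInf} (hw : Fixes n w)
    (ht : ∀ i, i + 1 < n → w.1 (i + 1) < w.1 i) {i : ℕ} (hi : i + 1 < n) :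
    s i * w = w * s (n - 2 - i) := by
  apply sinf_ext
  intro k
  rw [mul_val, mul_val]
  rcases lt_or_ge k n with hk | hk
  · have h1 : (s (n - 2 - i)).1 k < n := (fixes_s (by omega)).lt hk
    rw [val_of_top hw ht hk, val_of_top hw ht h1]
    simp only [s_val, Equiv.swap_apply_def]
    split_ifs <;> omega
  · rw [hw k hk, (fixes_s (n := n) (by omega)) k hk, (fixes_s (n := n) (by omega)) k hk, hw k hk]

/-- Downward induction through an ascent `j`, commuting the two divided differences. At the longest
element, left multiplication by `s i` is right multiplication by `s (n - 2 - i)`. -/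
theorem IsFam.ddY_eq {n : ℕ} {T : SInf → Poly} (hT : IsFam n T) {w : SInf} (hw : Fixes n w)
    {i : ℕ} (hi : i + 1 < n) : ddY i (T w) = if inv (s i * w) < inv w then T (s i * w) else 0 := by
  induction hm : n * n - inv w using Nat.strong_induction_on generalizing w with
  | _ m ih =>
  by_cases e : ∃ j, j + 1 < n ∧ w.1 j < w.1 (j + 1)
  · obtain ⟨j, hj, hlt⟩ := e
    have hw' := hw.mul (fixes_s hj)
    have l1 := hw'.inv_le
    have l2 := inv_mul_s_of_lt hlt
    have c1 := inv_s_mul_cases w i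
    have c2 := inv_s_mul_cases (w * s j) i
    have c3 := inv_mul_s_cases (s i * w) j
    rw [← mul_assoc] at c2
    have hsw : Fixes n (s i * w) := (fixes_s hi).mul hw
    rw [← hT.step w hw j hj hlt, ← ddX_ddY, ih _ (by omega) hw' rfl, ← mul_assoc]
    split_ifs with h1 h2 h2
    · exact hT.step _ hsw j hj ((lt_iff_inv_mul_s _ _).2 (by omega))
    · exact hT.ddX_of_ascent (hsw.mul (fixes_s hj)) hj
        ((lt_iff_inv_mul_s _ _).2 (by rw [mul_s_mul_s]; omega))
    -- Impossible: `s i * w * s j` and `s i * w` would differ in length by three.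
    · omega
    · exact ddX_zero j
  · have ht : ∀ i, i + 1 < n → w.1 (i + 1) < w.1 i := by
      intro i hi
      by_contra hc
      exact e ⟨i, hi, lt_of_le_of_ne (not_lt.1 hc) (apply_ne_succ w i)⟩
    rw [s_mul_top hw ht hi, if_pos ((inv_mul_s_lt_iff _ _).2 (ht _ (by omega))),
      ← hT.ddX_of_descent hw (by omega) (ht _ (by omega)), hT.top w hw ht, ddY_base hi]

/-! ### Homogeneity -/

/-- The homomorphism that multiplies every variable by a new variable. -/
def scaleVars : Poly →ₐ[ℤ] Polynomial Poly :=
  aeval fun v => Polynomial.X * Polynomial.C (X v)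

theorem scaleVars_x (i : ℕ) : scaleVars (x i) = Polynomial.X * Polynomial.C (x i) := by
  simp [scaleVars, x]

theorem scaleVars_y (i : ℕ) : scaleVars (y i) = Polynomial.X * Polynomial.C (y i) := by
  simp [scaleVars, y]

theorem scaleVars_sAct (i : ℕ) (f : Poly) :
    scaleVars (sAct i f) = Polynomial.map (sAct i).toRingHom (scaleVars f) := by
  have : scaleVars.comp (sAct i) = (Polynomial.mapAlgHom (sAct i)).comp scaleVars := by
    apply algHom_ext_xy <;> intro k
    · change scaleVars (sAct i (x k)) = Polynomial.map (sAct i).toRingHom (scaleVars (x k))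
      simp [sAct_x, scaleVars_x]
    · change scaleVars (sAct i (y k)) = Polynomial.map (sAct i).toRingHom (scaleVars (y k))
      simp [sAct_y, scaleVars_y]
  exact DFunLike.congr_fun this f

/-- The equation `scaleVars f = T ^ d * f` expresses homogeneity of degree `d`; the denominator
contributes one factor `T`, which cancels. -/
theorem scaleVars_ddX {i d : ℕ} {f : Poly}
    (hf : scaleVars f = Polynomial.X ^ (d + 1) * Polynomial.C f) :
    scaleVars (ddX i f) = Polynomial.X ^ d * Polynomial.C (ddX i f) := by
  have h1 := congrArg scaleVars (ddX_spec i f)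
  have h2 : Polynomial.map (sAct i).toRingHom (Polynomial.X ^ (d + 1) * Polynomial.C f) =
      Polynomial.X ^ (d + 1) * Polynomial.C (sAct i f) := by
    simp
  rw [map_sub, scaleVars_sAct, hf, h2, map_mul, map_sub, scaleVars_x, scaleVars_x, ← mul_sub,
    ← mul_sub, ← Polynomial.C_sub, ← Polynomial.C_sub, ddX_spec, Polynomial.C_mul] at h1
  have h3 : Polynomial.X * Polynomial.C (x i - x (i + 1)) ≠ 0 :=
    mul_ne_zero Polynomial.X_ne_zero (Polynomial.C_ne_zero.2 (x_sub_ne_zero (by omega)))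
  apply mul_left_cancel₀ h3
  rw [← h1]; ring

theorem scaleVars_prodDiagram (n : ℕ) (c : ℕ → ℕ) : scaleVars (prodDiagram n c) =
    Polynomial.X ^ (∑ i ∈ Finset.range n, c i) * Polynomial.C (prodDiagram n c) := by
  simp only [prodDiagram, map_prod, map_sub, scaleVars_x, scaleVars_y, ← mul_sub,
    Finset.prod_mul_distrib, Finset.prod_const, Finset.card_range, Finset.prod_pow_eq_pow_sum]

theorem IsFam.scaleVars_eq {n : ℕ} {T : SInf → Poly} (hT : IsFam n T) {w : SInf}
    (hw : Fixes n w) : scaleVars (T w) = Polynomial.X ^ inv w * Polynomial.C (T w) := by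
  induction hm : n * n - inv w using Nat.strong_induction_on generalizing w with
  | _ m ih =>
  by_cases e : ∃ j, j + 1 < n ∧ w.1 j < w.1 (j + 1)
  · obtain ⟨j, hj, hlt⟩ := e
    have hw' := hw.mul (fixes_s hj)
    have l1 := hw'.inv_le
    have l2 := inv_mul_s_of_lt hlt
    rw [← hT.step w hw j hj hlt]
    apply scaleVars_ddX
    rw [ih _ (by omega) hw' rfl, l2]
  · have ht : ∀ i, i + 1 < n → w.1 (i + 1) < w.1 i := by
      intro i hi
      by_contra hc
      exact e ⟨i, hi, lt_of_le_of_ne (not_lt.1 hc) (apply_ne_succ w i)⟩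
    rw [hT.top w hw ht, base, scaleVars_prodDiagram, inv_eq_sum_code hw]
    congr 2
    exact Finset.sum_congr rfl fun i hi => (code_of_top hw ht (Finset.mem_range.1 hi)).symm

theorem eval_zero_scaleVars (f : Poly) :
    Polynomial.eval 0 (scaleVars f) = C (constantCoeff f) := by
  have : (Polynomial.evalRingHom (0 : Poly)).comp scaleVars.toRingHom =
      (C : ℤ →+* Poly).comp constantCoeff := by
    apply MvPolynomial.ringHom_ext
    · intro r; simp
    · intro v; simp [scaleVars]
  exact DFunLike.congr_fun this f

theorem constantCoeff_eq_zero {f : Poly} {d : ℕ} (hd : d ≠ 0)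
    (hf : scaleVars f = Polynomial.X ^ d * Polynomial.C f) : constantCoeff f = 0 := by
  have h1 := eval_zero_scaleVars f
  rw [hf, Polynomial.eval_mul, Polynomial.eval_pow, Polynomial.eval_X, zero_pow hd, zero_mul] at h1
  exact C_injective (ℕ ⊕ ℕ) ℤ (h1.symm.trans C_0.symm)

theorem isDoubleSchubertFamily_schubert : IsDoubleSchubertFamily schubert := by
  have hN : ∀ (w : SInf) (i : ℕ), ∃ n, Fixes n w ∧ i + 1 < n := by
    intro w i
    obtain ⟨n, hn⟩ := exists_fixes w
    exact ⟨n + (i + 2), hn.mono (by omega), by omega⟩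
  constructor
  · intro w i
    obtain ⟨n, hn, hi⟩ := hN w i
    simp only [length_mul_s_lt_iff]
    split_ifs with hlt
    · exact (isFam_schubert n).ddX_of_descent hn hi hlt
    · exact (isFam_schubert n).ddX_of_ascent hn hi
        (lt_of_le_of_ne (not_lt.1 hlt) (apply_ne_succ w i))
  · intro w i
    obtain ⟨n, hn, hi⟩ := hN w i
    simp only [length_s_mul_lt_iff]
    exact (isFam_schubert n).ddY_eq hn hi
  · rw [(isFam_schubert 0).top 1 (fixes_one 0) (fun i hi => by omega)]
    simp [base, prodDiagram]
  · intro w hw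
    obtain ⟨n, hn⟩ := exists_fixes w
    refine constantCoeff_eq_zero ?_ ((isFam_schubert n).scaleVars_eq hn)
    obtain ⟨i, hi⟩ := exists_descent hw
    have := inv_mul_s_of_gt hi
    omega

/-! ### Uniqueness -/

theorem vars_shift {f : Poly} {u v : ℕ ⊕ ℕ} (hf : rename (Equiv.swap u v) f = f)
    (hu : u ∈ f.vars) : v ∈ f.vars := by
  classical
  rw [← hf] at hu
  have := MvPolynomial.vars_rename (Equiv.swap u v) f hu
  rw [Finset.mem_image] at this
  obtain ⟨t, ht, e⟩ := this
  have : t = v := (Equiv.swap u v).injective (e.trans (Equiv.swap_apply_right u v).symm)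
  rwa [← this]

theorem tAct_eq_rename (i : ℕ) :
    tAct i = rename (Equiv.swap (Sum.inr i) (Sum.inr (i + 1))) := by
  apply algHom_ext_xy <;> intro k
  · rw [tAct_x]
    simp only [x, rename_X]
    congr 1
  · rw [tAct_y]
    simp only [y, rename_X]
    congr 1
    simp only [Equiv.swap_apply_def, Sum.inr.injEq]
    split_ifs <;> rfl

/-- If one variable of an alphabet occurred, invariance would force all later ones to occur, against
finiteness of `vars`. -/
theorem eq_C_of_invariant {f : Poly} (hs : ∀ i, sAct i f = f) (ht : ∀ i, tAct i f = f) :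
    f = C (constantCoeff f) := by
  have key : ∀ g : ℕ → ℕ ⊕ ℕ, Function.Injective g → (∀ i, g i ∈ f.vars → g (i + 1) ∈ f.vars) →
      ∀ i, g i ∉ f.vars := by
    intro g hg hstep i hi
    have h1 : ∀ d, g (i + d) ∈ f.vars := by
      intro d
      induction d with
      | zero => exact hi
      | succ d ih => exact hstep _ ih
    have h2 : (Set.range fun d => g (i + d)).Infinite := by
      apply Set.infinite_range_of_injective
      intro a b e
      have := hg e
      omega
    apply h2
    apply (Finset.finite_toSet f.vars).subset
    rintro _ ⟨d, rfl⟩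
    exact h1 d
  have hx := key Sum.inl Sum.inl_injective fun i => vars_shift (hs i)
  have hy := key Sum.inr Sum.inr_injective fun i => vars_shift (by
    have := ht i
    rwa [tAct_eq_rename] at this)
  have hv : f.vars = ∅ := by
    rw [Finset.eq_empty_iff_forall_notMem]
    rintro (k | k)
    · exact hx k
    · exact hy k
  exact vars_eq_empty_iff_eq_C.1 hv

theorem IsDoubleSchubertFamily.unique {S T : SInf → Poly} (hS : IsDoubleSchubertFamily S)
    (hT : IsDoubleSchubertFamily T) : S = T := by
  funext w
  induction hd : length w using Nat.strong_induction_on generalizing w with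
  | _ d ih =>
  have hx : ∀ i, sAct i (S w - T w) = S w - T w := by
    intro i
    rw [← ddX_eq_zero_iff, ddX_sub, hS.ddX_eq, hT.ddX_eq]
    split_ifs with h1
    · rw [ih _ (by omega) _ rfl, sub_self]
    · rw [sub_self]
  have hy : ∀ i, tAct i (S w - T w) = S w - T w := by
    intro i
    rw [← ddY_eq_zero_iff, ddY_sub, hS.ddY_eq, hT.ddY_eq]
    split_ifs with h1
    · rw [ih _ (by omega) _ rfl, sub_self]
    · rw [sub_self]
  have h1 := eq_C_of_invariant hx hy
  have h2 : constantCoeff (S w - T w) = 0 := by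
    rw [map_sub]
    by_cases hw : w = 1
    · subst hw
      rw [hS.constantCoeff_one, hT.constantCoeff_one, sub_self]
    · rw [hS.constantCoeff_of_ne_one w hw, hT.constantCoeff_of_ne_one w hw, sub_self]
  rw [h2, C_0, sub_eq_zero] at h1
  exact h1

theorem existsUnique_isDoubleSchubertFamily :
    ∃! S : SInf → Poly, IsDoubleSchubertFamily S :=
  ⟨schubert, isDoubleSchubertFamily_schubert, fun _ hS =>
    hS.unique isDoubleSchubertFamily_schubert⟩

/-! ### Generating series -/

/-- The geometric series `1 / (1 - a T)`. -/
def geo (a : Poly) : PowerSeries Poly := PowerSeries.mk fun n => a ^ n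

theorem geo_mul (a : Poly) : (1 - PowerSeries.C a * PowerSeries.X) * geo a = 1 := by
  refine PowerSeries.ext fun n => ?_
  rw [sub_mul, one_mul, mul_assoc, map_sub, PowerSeries.coeff_C_mul]
  cases n with
  | zero => simp [geo]
  | succ n => simp [geo, PowerSeries.coeff_succ_X_mul, PowerSeries.coeff_one, pow_succ']

/-- The series `∏_{k < t} (1 - y_k T) / ∏_{k < r} (1 - x_k T)`. -/
def gf (r t : ℕ) : PowerSeries Poly :=
  (∏ k ∈ Finset.range r, geo (x k)) *
    ∏ k ∈ Finset.range t, (1 - PowerSeries.C (y k) * PowerSeries.X)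

theorem gf_succ_right (r t : ℕ) :
    gf r (t + 1) = (1 - PowerSeries.C (y t) * PowerSeries.X) * gf r t := by
  rw [gf, gf, Finset.prod_range_succ]; ring

theorem gf_succ_left (r t : ℕ) : gf (r + 1) t = geo (x r) * gf r t := by
  rw [gf, gf, Finset.prod_range_succ]; ring

theorem gf_eq_mul_gf_succ (r t : ℕ) :
    gf r t = (1 - PowerSeries.C (x r) * PowerSeries.X) * gf (r + 1) t := by
  rw [gf_succ_left, ← mul_assoc, geo_mul, one_mul]

theorem gf_zero_zero : gf 0 0 = 1 := by simp [gf]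

/-- The coefficients of a power series, extended by zero to negative degrees. -/
def coeffZ (f : PowerSeries Poly) (p : ℤ) : Poly :=
  if 0 ≤ p then PowerSeries.coeff p.toNat f else 0

theorem coeffZ_natCast (f : PowerSeries Poly) (p : ℕ) :
    coeffZ f p = PowerSeries.coeff p f := by
  simp [coeffZ]

theorem coeffZ_of_neg (f : PowerSeries Poly) {p : ℤ} (hp : p < 0) : coeffZ f p = 0 := by
  rw [coeffZ, if_neg (by omega)]

/-- The cutoff `N` is flexible: a term may be dropped because the coefficient of `q` vanishes or
because it would read `f` in negative degree. -/
theorem coeffZ_mul (q f : PowerSeries Poly) (p : ℤ) (N : ℕ)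
    (hN : ∀ i : ℕ, N ≤ i → PowerSeries.coeff i q = 0 ∨ p < i) :
    coeffZ (q * f) p = ∑ i ∈ Finset.range N, PowerSeries.coeff i q * coeffZ f (p - i) := by
  rcases lt_or_ge p 0 with hp | hp
  · rw [coeffZ_of_neg _ hp, Finset.sum_eq_zero]
    intro i _
    rw [coeffZ_of_neg _ (by omega), mul_zero]
  · lift p to ℕ using hp
    rw [coeffZ_natCast, PowerSeries.coeff_mul, Finset.Nat.sum_antidiagonal_eq_sum_range_succ
      fun a b => PowerSeries.coeff a q * PowerSeries.coeff b f]
    have h1 : ∀ i ∈ Finset.range p.succ, PowerSeries.coeff i q * PowerSeries.coeff (p - i) f =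
        PowerSeries.coeff i q * coeffZ f ((p : ℤ) - i) := by
      intro i hi
      rw [Finset.mem_range] at hi
      rw [← coeffZ_natCast f, Nat.cast_sub (by omega)]
    rw [Finset.sum_congr rfl h1]
    rcases le_total p.succ N with h2 | h2
    · apply Finset.sum_subset (Finset.range_mono h2)
      intro i _ hi
      rw [Finset.mem_range] at hi
      rw [coeffZ_of_neg _ (by omega), mul_zero]
    · symm
      apply Finset.sum_subset (Finset.range_mono h2)
      intro i hi hi'
      rw [Finset.mem_range] at hi hi'
      rcases hN i (by omega) with h3 | h3
      · rw [h3, zero_mul]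
      · omega

theorem coeffZ_X_mul (f : PowerSeries Poly) (p : ℤ) :
    coeffZ (PowerSeries.X * f) p = coeffZ f (p - 1) := by
  rw [coeffZ_mul _ _ _ 2]
  · simp [PowerSeries.coeff_X]
  · intro i hi
    left
    rw [PowerSeries.coeff_X, if_neg (by omega)]

theorem coeffZ_sub (f g : PowerSeries Poly) (p : ℤ) :
    coeffZ (f - g) p = coeffZ f p - coeffZ g p := by
  unfold coeffZ
  split_ifs
  · rw [map_sub]
  · rw [sub_zero]

theorem coeffZ_C_mul (a : Poly) (f : PowerSeries Poly) (p : ℤ) :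
    coeffZ (PowerSeries.C a * f) p = a * coeffZ f p := by
  unfold coeffZ
  split_ifs
  · rw [PowerSeries.coeff_C_mul]
  · rw [mul_zero]

/-- Multisets of size `p` correspond to exponent vectors of total degree `p`. -/
theorem coeff_prod_geo (z : ℕ → Poly) (r p : ℕ) :
    PowerSeries.coeff p (∏ k ∈ Finset.range r, geo (z k)) =
      aeval (fun k : Fin r => z k) (hsymm (Fin r) ℤ p) := by
  classical
  rw [Finset.prod_range (fun k => geo (z k)), PowerSeries.coeff_prod, hsymm, map_sum]
  symm
  refine Finset.sum_bij (fun a _ => (Sym.equivNatSum (Fin r) p a : Fin r →₀ ℕ)) ?_ ?_ ?_ ?_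
  · intro a _
    rw [Finset.mem_finsuppAntidiag]
    have h1 := (Sym.equivNatSum (Fin r) p a).2
    rw [Finsupp.sum_fintype _ _ (fun _ => rfl)] at h1
    exact ⟨h1, Finset.subset_univ _⟩
  · intro a _ b _ e
    exact (Sym.equivNatSum (Fin r) p).injective (Subtype.ext e)
  · intro b hb
    rw [Finset.mem_finsuppAntidiag] at hb
    refine ⟨(Sym.equivNatSum (Fin r) p).symm ⟨b, ?_⟩, Finset.mem_univ _, ?_⟩
    · rw [Finsupp.sum_fintype _ _ (fun _ => rfl)]
      exact hb.1
    · rw [Equiv.apply_symm_apply]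
  · intro a _
    simp only [map_multiset_prod, Multiset.map_map, Function.comp_def, aeval_X, geo,
      PowerSeries.coeff_mk]
    rw [Finset.prod_multiset_map_count]
    apply Finset.prod_subset (Finset.subset_univ _)
    intro k _ hk
    rw [Multiset.mem_toFinset, ← Multiset.count_eq_zero] at hk
    rw [hk, pow_zero]

theorem coeff_prod_linear (z : ℕ → Poly) (t p : ℕ) :
    PowerSeries.coeff p (∏ k ∈ Finset.range t, (1 - PowerSeries.C (z k) * PowerSeries.X)) =
      aeval (fun k : Fin t => -z k) (esymm (Fin t) ℤ p) := by
  classical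
  have h1 : ∀ k : Fin t, (1 - PowerSeries.C (z k) * PowerSeries.X : PowerSeries Poly) =
      1 + PowerSeries.C (-z k) * PowerSeries.X := by
    intro k; rw [map_neg]; ring
  rw [Finset.prod_range (fun k => (1 - PowerSeries.C (z k) * PowerSeries.X : PowerSeries Poly)),
    Finset.prod_congr rfl (fun k _ => h1 k), Finset.prod_one_add, map_sum, esymm, map_sum,
    Finset.powersetCard_eq_filter, Finset.sum_filter]
  apply Finset.sum_congr rfl
  intro a _
  rw [Finset.prod_mul_distrib, Finset.prod_const, ← map_prod, PowerSeries.coeff_C_mul_X_pow,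
    map_prod]
  simp only [aeval_X, eq_comm]

/-- Only nonnegative flags are needed, since both flags of an amenable permutation turn out to be
natural numbers. -/
theorem h_natCast (r t : ℕ) (p : ℤ) : h r t p = coeffZ (gf r t) p := by
  have e1 : ∀ i, hSym x r i = PowerSeries.coeff i (∏ k ∈ Finset.range r, geo (x k)) := by
    intro i
    rw [coeff_prod_geo, hSym, if_pos (Int.natCast_nonneg r)]
    rfl
  have e2 : ∀ i, eSym (fun k => -y k) t i =
      PowerSeries.coeff i (∏ k ∈ Finset.range t, (1 - PowerSeries.C (y k) * PowerSeries.X)) := by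
    intro i
    rw [coeff_prod_linear, eSym, if_pos (Int.natCast_nonneg t)]
    rfl
  unfold h coeffZ
  split_ifs
  · rw [gf, PowerSeries.coeff_mul, Finset.Nat.sum_antidiagonal_eq_sum_range_succ fun a b =>
      PowerSeries.coeff a (∏ k ∈ Finset.range r, geo (x k)) *
        PowerSeries.coeff b (∏ k ∈ Finset.range t, (1 - PowerSeries.C (y k) * PowerSeries.X))]
    exact Finset.sum_congr rfl fun i _ => by rw [e1, e2]
  · rfl

/-! ### Divided differences of the generating series -/

theorem sAct_coeffZ (i : ℕ) (f : PowerSeries Poly) (p : ℤ) :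
    sAct i (coeffZ f p) = coeffZ (PowerSeries.map (sAct i).toRingHom f) p := by
  unfold coeffZ
  split_ifs
  · rw [PowerSeries.coeff_map]; rfl
  · rw [map_zero]

theorem map_sAct_geo (i k : ℕ) : PowerSeries.map (sAct i).toRingHom (geo (x k)) =
    geo (x (Equiv.swap i (i + 1) k)) := by
  refine PowerSeries.ext fun n => ?_
  rw [PowerSeries.coeff_map, geo, geo, PowerSeries.coeff_mk, PowerSeries.coeff_mk, map_pow]
  change (sAct i (x k)) ^ n = _
  rw [sAct_x]

theorem map_sAct_linear (i k : ℕ) :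
    PowerSeries.map (sAct i).toRingHom (1 - PowerSeries.C (y k) * PowerSeries.X) =
      1 - PowerSeries.C (y k) * PowerSeries.X := by
  rw [map_sub, map_one, map_mul, PowerSeries.map_C, PowerSeries.map_X]
  change 1 - PowerSeries.C (sAct i (y k)) * _ = _
  rw [sAct_y]

/-- The variables `x i` and `x (i + 1)` are either both among the first `r` or both absent, unless
`r = i + 1`. -/
theorem map_sAct_gf {i r : ℕ} (hr : r ≠ i + 1) (t : ℕ) :
    PowerSeries.map (sAct i).toRingHom (gf r t) = gf r t := by
  rw [gf, map_mul, map_prod, map_prod]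
  congr 1
  · rw [Finset.prod_congr rfl (fun k _ => map_sAct_geo i k)]
    refine Finset.prod_bij' (fun k _ => Equiv.swap i (i + 1) k)
      (fun k _ => Equiv.swap i (i + 1) k) ?_ ?_ ?_ ?_ ?_
    · intro k hk
      simp only [Finset.mem_range, Equiv.swap_apply_def] at *
      split_ifs <;> omega
    · intro k hk
      simp only [Finset.mem_range, Equiv.swap_apply_def] at *
      split_ifs <;> omega
    · simp
    · simp
    · simp
  · exact Finset.prod_congr rfl fun k _ => map_sAct_linear i k

theorem sAct_coeffZ_gf {i r : ℕ} (hr : r ≠ i + 1) (t : ℕ) (p : ℤ) :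
    sAct i (coeffZ (gf r t) p) = coeffZ (gf r t) p := by
  rw [sAct_coeffZ, map_sAct_gf hr]

theorem geo_sub_geo (a b : Poly) :
    geo a - geo b = PowerSeries.C (a - b) * (PowerSeries.X * (geo b * geo a)) := by
  have h1 := geo_mul a
  have h2 := geo_mul b
  rw [map_sub]
  linear_combination (-geo a) * h2 + geo b * h1

/-- By `geo_sub_geo`, a divided difference of the factor `geo (x i)` adjoins `geo (x (i + 1))` and
one power of the series variable: the flag rises and the degree drops. -/
theorem ddX_coeffZ_gf (i t : ℕ) (p : ℤ) :
    ddX i (coeffZ (gf (i + 1) t) p) = coeffZ (gf (i + 2) t) (p - 1) := by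
  apply ddX_unique
  rw [sAct_coeffZ, ← coeffZ_sub, ← coeffZ_X_mul, ← coeffZ_C_mul, gf_succ_left, map_mul,
    map_sAct_gf (by omega), map_sAct_geo, Equiv.swap_apply_left, ← sub_mul, geo_sub_geo,
    gf_succ_left (i + 1), gf_succ_left i]
  simp only [mul_assoc]

/-- The determinant is linear in row `k` and the other rows are constants for the divided
difference. -/
theorem ddX_det {n : ℕ} (i : ℕ) (M : Matrix (Fin n) (Fin n) Poly) (k : Fin n)
    (hM : ∀ l, l ≠ k → ∀ j, sAct i (M l j) = M l j) :
    ddX i M.det = (M.updateRow k fun j => ddX i (M k j)).det := by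
  apply ddX_unique
  have h1 : sAct i M.det = (M.updateRow k fun j => sAct i (M k j)).det := by
    rw [AlgHom.map_det]
    congr 1
    ext l j
    by_cases hl : l = k
    · subst hl; simp
    · rw [Matrix.updateRow_ne hl]; exact congrArg _ (hM l hl j)
  have h2 : M = M.updateRow k
      (((x i - x (i + 1)) • fun j => ddX i (M k j)) + fun j => sAct i (M k j)) := by
    ext l j
    by_cases hl : l = k
    · subst hl
      rw [Matrix.updateRow_self, Pi.add_apply, Pi.smul_apply, smul_eq_mul, ← ddX_spec]
      rw [sub_add_cancel]
    · rw [Matrix.updateRow_ne hl]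
  have h3 := congrArg Matrix.det h2
  rw [Matrix.det_updateRow_add, Matrix.det_updateRow_smul] at h3
  rw [h1, h3, add_sub_cancel_right]

/-! ### Jacobi–Trudi determinants -/

/-- The flagged Jacobi–Trudi matrix with `n` rows. -/
def jtMatrix (n : ℕ) (F G : ℕ → ℕ) (μ : ℕ → ℤ) : Matrix (Fin n) (Fin n) Poly :=
  Matrix.of fun k j => coeffZ (gf (F k) (G k)) (μ k + j - k)

theorem jtMatrix_apply (n : ℕ) (F G : ℕ → ℕ) (μ : ℕ → ℤ) (k j : Fin n) :
    jtMatrix n F G μ k j = coeffZ (gf (F k) (G k)) (μ k + j - k) := rfl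

/-- The pairs `i < j` below `n`. -/
def pairsBelow (n : ℕ) : Finset Pair :=
  (Finset.range n ×ˢ Finset.range n).subtype fun p => p.1 < p.2

theorem mem_pairsBelow {n : ℕ} {p : Pair} : p ∈ pairsBelow n ↔ p.1.2 < n := by
  have := p.2
  simp only [pairsBelow, Finset.mem_subtype, Finset.mem_product, Finset.mem_range]
  omega

theorem jacobiTrudi_eq_sum {n : ℕ} {ρ β α : ℕ → ℤ} (hρ : ∀ k, n ≤ k → ρ k = 0)
    (hβ : ∀ k, n ≤ k → β k = 0) (hα : ∀ k, n ≤ k → α k = 0) :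
    jacobiTrudi ρ β α = ∑ D ∈ (pairsBelow n).powerset,
      (-1) ^ D.card * ∏ k : Fin n, h (ρ k) (β k) (raise D α k) := by
  rw [jacobiTrudi, finsum_eq_sum_of_support_subset (s := (pairsBelow n).powerset)]
  · apply Finset.sum_congr rfl
    intro D hD
    rw [Finset.mem_powerset] at hD
    congr 1
    rw [hSeq, finprod_eq_prod_of_mulSupport_subset (s := Finset.range n), Finset.prod_range]
    intro k hk
    by_contra hkn
    simp only [Finset.coe_range, Set.mem_Iio, not_lt] at hkn
    apply hk
    have h0 : raise D α k = 0 := by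
      rw [raise_apply, hα k hkn, zero_add]
      apply Finset.sum_eq_zero
      intro p hp
      have h1 := mem_pairsBelow.1 (hD hp)
      have h2 := p.2
      rw [if_neg (by omega), if_neg (by omega), sub_zero]
    simp only
    rw [h0, hρ k hkn, hβ k hkn, h_zero_zero_zero]
  · intro D hD
    rw [Finset.mem_coe, Finset.mem_powerset]
    intro p hp
    exact mem_pairsBelow.2 (support_jacobiTrudi ρ β α n hρ hβ hα D hD p hp)

/-- The monomial with the given integer exponents in the ring of Laurent polynomials. -/
def laurent (a : ℕ → ℤ) : AddMonoidAlgebra ℤ (ℕ → ℤ) := AddMonoidAlgebra.single a 1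

theorem laurent_mul (a b : ℕ → ℤ) : laurent a * laurent b = laurent (a + b) := by
  simp [laurent, AddMonoidAlgebra.single_mul_single]

theorem laurent_zero : laurent 0 = 1 := rfl

theorem laurent_sum {ι : Type*} (t : Finset ι) (a : ι → ℕ → ℤ) :
    laurent (∑ i ∈ t, a i) = ∏ i ∈ t, laurent (a i) := by
  classical
  induction t using Finset.induction_on with
  | empty => rw [Finset.sum_empty, Finset.prod_empty, laurent_zero]
  | insert i t hi ih => rw [Finset.sum_insert hi, Finset.prod_insert hi, ← ih, laurent_mul]

theorem laurent_single_pow (i : ℕ) (a : ℤ) (m : ℕ) :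
    laurent (Pi.single i a) ^ m = laurent (Pi.single i (m * a)) := by
  induction m with
  | zero => simp [laurent_zero]
  | succ m ih =>
    rw [pow_succ, ih, laurent_mul, ← Pi.single_add]
    congr 2
    push_cast; ring

/-- The linear extension to Laurent polynomials of `α ↦ h^β_α`, for sequences of length `n`. -/
def hLinear (n : ℕ) (ρ β : ℕ → ℤ) : AddMonoidAlgebra ℤ (ℕ → ℤ) →ₗ[ℤ] Poly :=
  (Finsupp.linearCombination ℤ fun a : ℕ → ℤ => ∏ k : Fin n, h (ρ k) (β k) (a k)) ∘ₗ
    (AddMonoidAlgebra.coeffLinearEquiv ℤ).toLinearMap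

theorem hLinear_laurent (n : ℕ) (ρ β a : ℕ → ℤ) :
    hLinear n ρ β (laurent a) = ∏ k : Fin n, h (ρ k) (β k) (a k) := by
  have : (AddMonoidAlgebra.coeffLinearEquiv ℤ) (laurent a) = Finsupp.single a 1 := rfl
  rw [hLinear, LinearMap.comp_apply, LinearEquiv.coe_coe, this, Finsupp.linearCombination_single,
    one_smul]

theorem prod_pairsBelow {M : Type*} [CommMonoid M] (n : ℕ) (f : ℕ → ℕ → M) :
    ∏ p ∈ pairsBelow n, f p.1.1 p.1.2 = ∏ i : Fin n, ∏ j ∈ Finset.Ioi i, f i j := by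
  rw [Finset.prod_sigma']
  refine Finset.prod_bij' (fun p hp => ⟨⟨p.1.1, ?_⟩, ⟨p.1.2, mem_pairsBelow.1 hp⟩⟩)
    (fun q hq => ⟨(q.1, q.2), ?_⟩) ?_ ?_ ?_ ?_ ?_
  · have := mem_pairsBelow.1 hp
    have := p.2
    omega
  · simpa using hq
  · intro p hp
    simpa using p.2
  · intro q hq
    exact mem_pairsBelow.2 q.2.2
  · intro p hp; rfl
  · intro q hq; rfl
  · intro p hp; rfl

/-- This is the Vandermonde determinant after extracting a monomial from each row. Raising operators
act on indices and not on the polynomials `h`, so the identity is established for formal monomials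
first. -/
theorem raising_eq_det (n : ℕ) (α : ℕ → ℤ) :
    laurent (∑ k : Fin n, Pi.single (k : ℕ) (α k)) *
      ∏ p ∈ pairsBelow n, (1 - laurent (Pi.single p.1.1 1 - Pi.single p.1.2 1)) =
    (Matrix.of fun k j : Fin n => laurent (Pi.single (k : ℕ) (α k + j - k))).det := by
  have h1 : (Matrix.of fun k j : Fin n => laurent (Pi.single (k : ℕ) (α k + j - k))) =
      Matrix.of fun k j : Fin n => laurent (Pi.single (k : ℕ) (α k - k)) *
        Matrix.vandermonde (fun k : Fin n => laurent (Pi.single (k : ℕ) 1)) k j := by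
    refine Matrix.ext fun k j => ?_
    rw [Matrix.of_apply, Matrix.of_apply, Matrix.vandermonde_apply, laurent_single_pow,
      laurent_mul, ← Pi.single_add]
    ring_nf
  have h2 : ∀ p : Pair, (1 - laurent (Pi.single p.1.1 1 - Pi.single p.1.2 1)) =
      laurent (Pi.single p.1.2 (-1)) *
        (laurent (Pi.single p.1.2 1) - laurent (Pi.single p.1.1 1)) := by
    intro p
    rw [mul_sub, laurent_mul, laurent_mul, ← Pi.single_add, neg_add_cancel, Pi.single_zero,
      laurent_zero, Pi.single_neg, neg_add_eq_sub]
  have h3 : ∏ i : Fin n, ∏ j ∈ Finset.Ioi i, laurent (Pi.single (j : ℕ) (-1)) =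
      ∏ j : Fin n, laurent (Pi.single (j : ℕ) (-j : ℤ)) := by
    rw [Finset.prod_comm' (t' := Finset.univ) (s' := fun j => Finset.Iio j) (by simp)]
    refine Finset.prod_congr rfl fun j _ => ?_
    rw [Finset.prod_const, Fin.card_Iio, laurent_single_pow]
    congr 2
    ring
  rw [h1, Matrix.det_mul_column, Matrix.det_vandermonde, Finset.prod_congr rfl fun p _ => h2 p,
    prod_pairsBelow n fun i j => laurent (Pi.single j (-1)) *
      (laurent (Pi.single j 1) - laurent (Pi.single i 1))]
  simp only [Finset.prod_mul_distrib]
  rw [h3, laurent_sum, ← mul_assoc, ← Finset.prod_mul_distrib]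
  congr 1
  refine Finset.prod_congr rfl fun k _ => ?_
  rw [laurent_mul, ← Pi.single_add, sub_eq_add_neg]

theorem jacobiTrudi_eq_det {n : ℕ} {F G : ℕ → ℕ} {α : ℕ → ℤ} (hF : ∀ k, n ≤ k → F k = 0)
    (hG : ∀ k, n ≤ k → G k = 0) (hα : ∀ k, n ≤ k → α k = 0) :
    jacobiTrudi (fun k => F k) (fun k => G k) α = (jtMatrix n F G α).det := by
  classical
  have hα' : α = ∑ k : Fin n, Pi.single (k : ℕ) (α k) := by
    funext i
    rw [Finset.sum_apply, ← Finset.sum_range (fun k => (Pi.single k (α k) : ℕ → ℤ) i)]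
    simp only [Pi.single_apply]
    rw [Finset.sum_ite_eq]
    split_ifs with hi
    · rfl
    · exact hα i (by simpa using hi)
  have h1 := congrArg (hLinear n (fun k => F k) (fun k => G k)) (raising_eq_det n α)
  rw [← hα'] at h1
  have h2 : ∏ p ∈ pairsBelow n, (1 - laurent (Pi.single p.1.1 1 - Pi.single p.1.2 1)) =
      ∑ D ∈ (pairsBelow n).powerset,
        (-1 : ℤ) ^ D.card • laurent (∑ p ∈ D, (Pi.single p.1.1 1 - Pi.single p.1.2 1)) := by
    simp only [sub_eq_add_neg (1 : AddMonoidAlgebra ℤ (ℕ → ℤ))]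
    rw [Finset.prod_one_add]
    refine Finset.sum_congr rfl fun D _ => ?_
    rw [Finset.prod_neg, laurent_sum, zsmul_eq_mul]
    push_cast
    rfl
  rw [h2, Finset.mul_sum, map_sum] at h1
  rw [jacobiTrudi_eq_sum (n := n) (fun k hk => by simp [hF k hk]) (fun k hk => by simp [hG k hk])
    hα]
  refine Eq.trans (Finset.sum_congr rfl fun D _ => ?_) (h1.trans ?_)
  · rw [mul_smul_comm, laurent_mul, map_zsmul, hLinear_laurent, zsmul_eq_mul]
    push_cast
    rfl
  -- `hLinear` is only linear, so it is applied to the Leibniz expansion termwise. After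
  -- transposition each term has one factor per row, hence is a single monomial whose image is the
  -- product of the matching entries.
  · rw [← Matrix.det_transpose, Matrix.det_apply', ← Matrix.det_transpose (jtMatrix n F G α),
      Matrix.det_apply', map_sum]
    refine Finset.sum_congr rfl fun σ _ => ?_
    rw [← zsmul_eq_mul, map_zsmul, zsmul_eq_mul]
    congr 1
    simp only [Matrix.transpose_apply, Matrix.of_apply, jtMatrix_apply]
    rw [← laurent_sum, hLinear_laurent]
    refine Finset.prod_congr rfl fun k _ => ?_
    rw [h_natCast, Finset.sum_apply, Finset.sum_eq_single k]
    · rw [Pi.single_eq_same]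
    · intro l _ hl
      rw [Pi.single_eq_of_ne]
      intro e
      exact hl (Fin.ext e.symm)
    · simp

/-! ### Row and column operations -/

theorem det_eq_of_unitriangular {n : ℕ} {R : Type*} [CommRing R] {U M N : Matrix (Fin n) (Fin n) R}
    (hU : ∀ i j, j < i → U i j = 0) (hd : ∀ i, U i i = 1) (e : M = U * N) : M.det = N.det := by
  rw [e, Matrix.det_mul, Matrix.det_of_isUpperTriangular (fun i j hij => hU i j hij),
    Finset.prod_congr rfl fun i _ => hd i, Finset.prod_const_one, one_mul]

theorem coeff_prod_linear_eq_zero {ι : Type*} (s : Finset ι) (z : ι → Poly) {i : ℕ} (hi : s.card < i) :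
    PowerSeries.coeff i (∏ k ∈ s, (1 - PowerSeries.C (z k) * PowerSeries.X)) = 0 := by
  classical
  induction s using Finset.induction_on generalizing i with
  | empty =>
    rw [Finset.prod_empty, PowerSeries.coeff_one, if_neg (by omega)]
  | insert k s hk ih =>
    rw [Finset.card_insert_of_notMem hk] at hi
    rw [Finset.prod_insert hk, sub_mul, one_mul, map_sub, mul_assoc, PowerSeries.coeff_C_mul,
      ih (by omega)]
    obtain ⟨j, rfl⟩ : ∃ j, i = j + 1 := ⟨i - 1, by omega⟩
    rw [PowerSeries.coeff_succ_X_mul, ih (by omega), mul_zero, sub_zero]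

theorem coeff_zero_prod_linear (s : Finset ℕ) (z : ℕ → Poly) :
    PowerSeries.coeff 0 (∏ k ∈ s, (1 - PowerSeries.C (z k) * PowerSeries.X)) = 1 := by
  rw [PowerSeries.coeff_zero_eq_constantCoeff_apply, map_prod]
  simp

/-- Informally, the coefficient of top degree evaluates the reversed polynomial `∏ (T - y k)` at
`a`; the induction peels off one factor using `geo_mul`. -/
theorem coeff_prod_linear_mul_geo (a : Poly) (t : ℕ) :
    PowerSeries.coeff t ((∏ k ∈ Finset.range t, (1 - PowerSeries.C (y k) * PowerSeries.X)) * geo a)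
      = ∏ k ∈ Finset.range t, (a - y k) := by
  induction t with
  | zero => simp [geo]
  | succ t ih =>
    set Q := ∏ k ∈ Finset.range t, (1 - PowerSeries.C (y k) * PowerSeries.X) with hQ
    have h1 : (∏ k ∈ Finset.range (t + 1), (1 - PowerSeries.C (y k) * PowerSeries.X)) * geo a =
        Q + PowerSeries.C (a - y t) * (PowerSeries.X * (Q * geo a)) := by
      rw [Finset.prod_range_succ, map_sub]
      linear_combination Q * geo_mul a
    rw [h1, map_add, hQ, coeff_prod_linear_eq_zero _ _ (by simp), PowerSeries.coeff_C_mul,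
      PowerSeries.coeff_succ_X_mul, ih, Finset.prod_range_succ]
    ring

theorem prod_linear_mul_gf (q k t : ℕ) (hq : q ≤ k) :
    (∏ i ∈ Finset.range q, (1 - PowerSeries.C (x i) * PowerSeries.X)) * gf k t =
      (∏ i ∈ Finset.Ico q k, geo (x i)) *
        ∏ i ∈ Finset.range t, (1 - PowerSeries.C (y i) * PowerSeries.X) := by
  rw [gf, ← Finset.prod_range_mul_prod_Ico _ hq]
  have : (∏ i ∈ Finset.range q, (1 - PowerSeries.C (x i) * PowerSeries.X)) *
      ∏ i ∈ Finset.range q, geo (x i) = 1 := by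
    rw [← Finset.prod_mul_distrib, Finset.prod_congr rfl fun i _ => geo_mul (x i),
      Finset.prod_const_one]
  rw [← mul_assoc, ← mul_assoc, this, one_mul]

/-- The Jacobi–Trudi determinant with flags `1, 2, …` and `c` is a product over the cells. -/
theorem det_jtMatrix_diagram (n : ℕ) (c : ℕ → ℕ) :
    (jtMatrix n (fun k => k + 1) c fun k => c k).det = prodDiagram n c := by
  -- Column operations: multiplication by `V` multiplies the series behind column `q` by `∏_{i<q} (1
  -- - x_i T)`, cancelling denominators.
  set V : Matrix (Fin n) (Fin n) Poly := Matrix.of fun j q => if (j : ℕ) ≤ q then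
    PowerSeries.coeff ((q : ℕ) - j) (∏ i ∈ Finset.range q, (1 - PowerSeries.C (x i) * PowerSeries.X))
    else 0 with hV
  have hVdet : V.det = 1 := by
    rw [Matrix.det_of_isUpperTriangular]
    · apply Finset.prod_eq_one
      intro i _
      rw [hV, Matrix.of_apply, if_pos le_rfl, Nat.sub_self, coeff_zero_prod_linear]
    · intro i j hij
      exact if_neg (not_le.2 (show (j : ℕ) < i from hij))
  have key : ∀ k q : Fin n, (jtMatrix n (fun k => k + 1) c (fun k => c k) * V) k q =
      coeffZ ((∏ i ∈ Finset.range q, (1 - PowerSeries.C (x i) * PowerSeries.X)) *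
        gf (k + 1) (c k)) (c k + q - k) := by
    intro k q
    rw [coeffZ_mul _ _ _ (q + 1)]
    · rw [← Finset.sum_range_reflect, Matrix.mul_apply]
      simp only [hV, Matrix.of_apply, jtMatrix_apply]
      rw [← Finset.sum_range fun j : ℕ => coeffZ (gf (k + 1) (c k)) ((c k : ℤ) + j - k) *
        if j ≤ q then PowerSeries.coeff ((q : ℕ) - j)
          (∏ i ∈ Finset.range q, (1 - PowerSeries.C (x i) * PowerSeries.X)) else 0]
      symm
      apply Finset.sum_subset_zero_on_sdiff (Finset.range_mono q.2)
      · intro j hj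
        rw [Finset.mem_sdiff, Finset.mem_range, Finset.mem_range] at hj
        rw [if_neg (by omega), mul_zero]
      · intro j hj
        rw [Finset.mem_range] at hj
        rw [if_pos (by omega), mul_comm, show (q : ℕ) + 1 - 1 - j = q - j by omega,
          Nat.cast_sub (by omega)]
        congr 2
        ring
    · intro i hi
      left
      exact coeff_prod_linear_eq_zero _ _ (by rw [Finset.card_range]; omega)
  rw [← mul_one (Matrix.det _), ← hVdet, ← Matrix.det_mul, Matrix.det_of_isLowerTriangular,
    prodDiagram, Finset.prod_range]
  · refine Finset.prod_congr rfl fun k _ => ?_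
    rw [key, prod_linear_mul_gf _ _ _ (Nat.le_succ _), Nat.Ico_succ_singleton, Finset.prod_singleton,
      add_sub_cancel_right, coeffZ_natCast, mul_comm, coeff_prod_linear_mul_geo]
  · intro k q hkq
    have hkq' : (k : ℕ) < q := hkq
    rw [key, ← Finset.prod_range_mul_prod_Ico _ (show (k : ℕ) + 1 ≤ q from hkq'),
      mul_right_comm, prod_linear_mul_gf _ _ _ le_rfl, Finset.Ico_self, Finset.prod_empty, one_mul]
    -- To the right of the diagonal all denominators have cancelled. What remains is a polynomial of
    -- degree at most `c k + (q - k - 1)`, one less than the coefficient read off.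
    have h1 : (∏ i ∈ Finset.range (c k), (1 - PowerSeries.C (y i) * PowerSeries.X)) *
        ∏ i ∈ Finset.Ico ((k : ℕ) + 1) q, (1 - PowerSeries.C (x i) * PowerSeries.X) =
        ∏ i ∈ (Finset.range (c k)).disjSum (Finset.Ico ((k : ℕ) + 1) q),
          (1 - PowerSeries.C (Sum.elim y x i) * PowerSeries.X) := by
      rw [Finset.prod_disjSum]; rfl
    rw [h1, coeffZ, if_pos (by omega), coeff_prod_linear_eq_zero]
    rw [Finset.card_disjSum, Finset.card_range, Nat.card_Ico]
    omega

/-! ### Modifications of dominant permutations -/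

/-- Every inversion of `u⁻¹` is an inversion of `v`. -/
def Removes (v u : SInf) : Prop :=
  ∀ k l, k < l → (u⁻¹).1 l < (u⁻¹).1 k → v.1 l < v.1 k

/-- The symmetric difference of the inversion sets of `v` and `u⁻¹` injects into the inversions of
`v * u`. If `v * u` is shorter than `v` by the full length of `u`, counting forces the inversions of
`u⁻¹` to lie in those of `v`. -/
theorem removes_of_length {v u : SInf} (e : length (v * u) + length u = length v) :
    Removes v u := by
  classical
  rw [length_eq_inv, length_eq_inv, length_eq_inv, ← inv_inv u] at e
  have hfin : (symmDiff (invSet v) (invSet u⁻¹)).Finite :=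
    ((invSet_finite v).union (invSet_finite u⁻¹)).subset symmDiff_le_sup
  have h1 : (symmDiff (invSet v) (invSet u⁻¹)).ncard ≤ inv (v * u) := by
    -- A pair of values is sent to the sorted pair of its positions in the word of `u`.
    refine Set.ncard_le_ncard_of_injOn (fun p : ℕ × ℕ => if (u⁻¹).1 p.1 < (u⁻¹).1 p.2 then
      ((u⁻¹).1 p.1, (u⁻¹).1 p.2) else ((u⁻¹).1 p.2, (u⁻¹).1 p.1)) ?_ ?_ (invSet_finite _)
    · rintro ⟨a, b⟩ hp
      have hab : a ≠ b := by
        rintro rfl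
        simp [Set.mem_symmDiff, invSet] at hp
      have h2 : (u⁻¹).1 a ≠ (u⁻¹).1 b := fun h => hab ((u⁻¹).1.injective h)
      have h3 : v.1 a ≠ v.1 b := fun h => hab (v.1.injective h)
      simp only [Set.mem_symmDiff, invSet, Set.mem_ofPred_eq] at hp ⊢
      split_ifs with h4
      · simp only [mul_val, apply_inv_val]
        omega
      · simp only [mul_val, apply_inv_val]
        omega
    · rintro ⟨a, b⟩ hp ⟨c, d⟩ hq e
      have hab : a < b := by
        simp only [Set.mem_symmDiff, invSet, Set.mem_ofPred_eq] at hp; omega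
      have hcd : c < d := by
        simp only [Set.mem_symmDiff, invSet, Set.mem_ofPred_eq] at hq; omega
      simp only at e
      split_ifs at e <;> simp only [Prod.mk.injEq, EmbeddingLike.apply_eq_iff_eq] at e <;>
        simp only [Prod.mk.injEq] <;> omega
  have h2 : (symmDiff (invSet v) (invSet u⁻¹)).ncard =
      (invSet v \ invSet u⁻¹).ncard + (invSet u⁻¹ \ invSet v).ncard := by
    rw [Set.symmDiff_def, Set.ncard_union_eq disjoint_sdiff_sdiff ((invSet_finite v).sdiff)
      ((invSet_finite _).sdiff)]
  have h3 := Set.ncard_inter_add_ncard_sdiff_eq_ncard (invSet v) (invSet u⁻¹) (invSet_finite _)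
  have h4 := Set.ncard_inter_add_ncard_sdiff_eq_ncard (invSet u⁻¹) (invSet v) (invSet_finite _)
  rw [Set.inter_comm] at h4
  have h5 : (invSet u⁻¹ \ invSet v).ncard = 0 := by
    unfold inv at *
    omega
  rw [Set.ncard_eq_zero (invSet_finite _).sdiff, Set.sdiff_eq_empty] at h5
  intro k l hkl hlt
  exact (h5 (show (k, l) ∈ invSet u⁻¹ from ⟨hkl, hlt⟩)).2

theorem lt_of_code_inv_eq_zero {u : SInf} {k : ℕ} (hk : code u⁻¹ k = 0) {l : ℕ} (hl : k < l) :
    (u⁻¹).1 k < (u⁻¹).1 l := by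
  rw [code, Set.ncard_eq_zero (codeSet_finite _ _)] at hk
  by_contra hc
  have h1 : (u⁻¹).1 l ≠ (u⁻¹).1 k := fun h => by
    have := (u⁻¹).1.injective h
    omega
  have h2 : l ∈ {j : ℕ | k < j ∧ (u⁻¹).1 j < (u⁻¹).1 k} := ⟨hl, by omega⟩
  rw [hk] at h2
  exact h2

/-- Counts the `p` entries in positions below `p`, the values below `k` all being among them. -/
theorem position_eq {u : SInf} {p k : ℕ} (hk : ∀ j < k, (u⁻¹).1 j < p) :
    p = k + {l : ℕ | k ≤ l ∧ (u⁻¹).1 l < p}.ncard := by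
  have h1 : {l : ℕ | (u⁻¹).1 l < p} = u.1 '' ↑(Finset.range p) := by
    ext l
    simp only [Set.mem_ofPred_eq, Set.mem_image, Finset.coe_range, Set.mem_Iio]
    constructor
    · intro h
      exact ⟨_, h, apply_inv_val u l⟩
    · rintro ⟨a, ha, rfl⟩
      rwa [inv_val_apply]
  have h2 : {l : ℕ | (u⁻¹).1 l < p} =
      ↑(Finset.range k) ∪ {l : ℕ | k ≤ l ∧ (u⁻¹).1 l < p} := by
    ext l
    simp only [Set.mem_ofPred_eq, Set.mem_union, Finset.coe_range, Set.mem_Iio]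
    constructor
    · intro h
      rcases lt_or_ge l k with h3 | h3
      · exact .inl h3
      · exact .inr ⟨h3, h⟩
    · rintro (h | h)
      · exact hk l h
      · exact h.2
  have hfin : {l : ℕ | (u⁻¹).1 l < p}.Finite := by
    rw [h1]; exact (Finset.finite_toSet _).image _
  have h3 : {l : ℕ | (u⁻¹).1 l < p}.ncard = p := by
    rw [h1, Set.ncard_image_of_injective _ u.1.injective, Set.ncard_coe_finset, Finset.card_range]
  rw [h2, Set.ncard_union_eq ?_ (Finset.finite_toSet _) (hfin.subset fun l hl => hl.2),
    Set.ncard_coe_finset, Finset.card_range] at h3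
  · exact h3.symm
  · rw [Set.disjoint_left]
    intro l hl hl'
    simp only [Set.mem_ofPred_eq, Finset.coe_range, Set.mem_Iio] at hl hl'
    omega

theorem s_lt_s {i a b : ℕ} (hab : a < b) (hne : ¬ (a = i ∧ b = i + 1)) :
    (s i).1 a < (s i).1 b := by
  simp only [s_val, Equiv.swap_apply_def]
  split_ifs <;> omega

theorem s_s_val (i a : ℕ) : (s i).1 ((s i).1 a) = a := by simp [s_val]

theorem inv_mul_s_val (u : SInf) (i k : ℕ) : ((u * s i)⁻¹).1 k = (s i).1 ((u⁻¹).1 k) := by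
  rw [mul_inv_rev, s_inv, mul_val]

/-- A non-trivial `231`-avoiding permutation has a descent whose smaller entry `k` is preceded by
all smaller entries. -/
theorem exists_min_descent {u : SInf} (hu : u ≠ 1) :
    ∃ i k, u.1 (i + 1) = k ∧ k < u.1 i ∧ (∀ j < k, code u⁻¹ j = 0) ∧ i + 1 = k + code u⁻¹ k := by
  classical
  have hex : ∃ k, code u⁻¹ k ≠ 0 := by
    by_contra! hcon
    apply hu
    obtain ⟨n, hn⟩ := exists_fixes u
    have h1 : inv u = 0 := by
      rw [← inv_inv, inv_eq_sum_code hn.inverse]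
      exact Finset.sum_eq_zero fun i _ => hcon i
    by_contra hne
    obtain ⟨i, hi⟩ := exists_descent hne
    have := inv_mul_s_of_gt hi
    omega
  -- The smallest value with a larger entry to its left.
  set k := Nat.find hex with hk
  have hmin : ∀ j < k, code u⁻¹ j = 0 := fun j hj => not_not.1 (Nat.find_min hex hj)
  have hck : code u⁻¹ k ≠ 0 := Nat.find_spec hex
  have hset : {l : ℕ | k ≤ l ∧ (u⁻¹).1 l < (u⁻¹).1 k} =
      {l : ℕ | k < l ∧ (u⁻¹).1 l < (u⁻¹).1 k} := by
    ext l
    simp only [Set.mem_ofPred_eq]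
    constructor
    · rintro ⟨h1, h2⟩
      refine ⟨lt_of_le_of_ne h1 ?_, h2⟩
      rintro rfl
      omega
    · rintro ⟨h1, h2⟩
      exact ⟨h1.le, h2⟩
  have hp := position_eq (u := u) (p := (u⁻¹).1 k) (k := k)
    fun j hj => lt_of_code_inv_eq_zero (hmin j hj) hj
  rw [hset] at hp
  change _ = k + code u⁻¹ k at hp
  obtain ⟨i, hi⟩ : ∃ i, (u⁻¹).1 k = i + 1 := ⟨(u⁻¹).1 k - 1, by omega⟩
  have hik : u.1 (i + 1) = k := by rw [← hi, apply_inv_val]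
  refine ⟨i, k, hik, ?_, hmin, by omega⟩
  -- If the entry just before `k` were smaller than `k`, the larger entries preceding `k` would also
  -- precede it, against minimality.
  by_contra hc
  have hd : u.1 i < k := by
    refine lt_of_le_of_ne (not_lt.1 hc) fun h => ?_
    have := u.1.injective (h.trans hik.symm)
    omega
  obtain ⟨l, hl1, hl2⟩ := (Set.ncard_pos (codeSet_finite _ _)).1 (Nat.pos_of_ne_zero hck)
  have h1 := lt_of_code_inv_eq_zero (hmin _ hd) (show u.1 i < l by omega)
  rw [inv_val_apply] at h1
  omega

theorem code_inv_mul_s_of_ne {u : SInf} {i : ℕ} (hi : u.1 (i + 1) < u.1 i) {m : ℕ}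
    (hm : m ≠ u.1 (i + 1)) : code (u * s i)⁻¹ m = code u⁻¹ m := by
  rw [code, code]
  congr 1
  ext l
  simp only [Set.mem_ofPred_eq, inv_mul_s_val]
  refine and_congr_right fun hl => ?_
  constructor
  · intro h
    have h1 := s_lt_s (i := i) h (by
      rintro ⟨h2, h3⟩
      have h4 : (u⁻¹).1 l = i + 1 := by rw [← s_s_val i ((u⁻¹).1 l), h2, s_apply_left]
      have h5 : (u⁻¹).1 m = i := by rw [← s_s_val i ((u⁻¹).1 m), h3, s_apply_right]
      have h6 : l = u.1 (i + 1) := by rw [← h4, apply_inv_val]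
      have h7 : m = u.1 i := by rw [← h5, apply_inv_val]
      omega)
    rwa [s_s_val, s_s_val] at h1
  · intro h
    refine s_lt_s h ?_
    rintro ⟨h2, h3⟩
    exact hm (by rw [← h3, apply_inv_val])

theorem code_inv_mul_s_self {u : SInf} {i : ℕ} (hi : u.1 (i + 1) < u.1 i) :
    code (u * s i)⁻¹ (u.1 (i + 1)) + 1 = code u⁻¹ (u.1 (i + 1)) := by
  have e : {l : ℕ | u.1 (i + 1) < l ∧ (u⁻¹).1 l < (u⁻¹).1 (u.1 (i + 1))} =
      insert (u.1 i) {l : ℕ | u.1 (i + 1) < l ∧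
        ((u * s i)⁻¹).1 l < ((u * s i)⁻¹).1 (u.1 (i + 1))} := by
    ext l
    simp only [Set.mem_ofPred_eq, Set.mem_insert_iff, inv_mul_s_val, inv_val_apply, s_apply_right]
    constructor
    · rintro ⟨h1, h2⟩
      by_cases h3 : (u⁻¹).1 l = i
      · left
        rw [← h3, apply_inv_val]
      · right
        rw [s_apply_of_ne h3 (by omega)]
        exact ⟨h1, by omega⟩
    · rintro (rfl | ⟨h1, h2⟩)
      · rw [inv_val_apply]
        exact ⟨hi, by omega⟩
      · refine ⟨h1, ?_⟩
        have h3 : (u⁻¹).1 l ≠ i := fun h => by rw [h, s_apply_left] at h2; omega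
        have h4 : (u⁻¹).1 l ≠ i + 1 := fun h => by
          have : l = u.1 (i + 1) := by rw [← h, apply_inv_val]
          omega
        rw [s_apply_of_ne h3 h4] at h2
        omega
  rw [code, code, e, Set.ncard_insert_of_notMem _ (codeSet_finite _ _)]
  simp only [Set.mem_ofPred_eq, inv_mul_s_val, inv_val_apply, s_apply_left, s_apply_right]
  omega

/-- A new pattern must use positions `i` and `i + 1`. They cannot be the `31`, being in increasing
order now; as the `23` they need a later entry below `u.1 (i + 1)`, which by `hmin` has nothing
larger before it. -/
theorem avoids231_mul_s {u : SInf} (hu : Avoids231 u) {i : ℕ} (hi : u.1 (i + 1) < u.1 i)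
    (hmin : ∀ j < u.1 (i + 1), code u⁻¹ j = 0) : Avoids231 (u * s i) := by
  rintro ⟨a, b, e, hab, hbe, h1, h2⟩
  simp only [mul_val] at h1 h2
  by_cases h3 : a = i ∧ b = i + 1
  · obtain ⟨rfl, rfl⟩ := h3
    rw [s_apply_left, s_apply_of_ne (k := e) (by omega) (by omega)] at h1
    have := lt_of_code_inv_eq_zero (hmin _ h1) h1
    rw [inv_val_apply, inv_val_apply] at this
    omega
  by_cases h4 : b = i ∧ e = i + 1
  · obtain ⟨rfl, rfl⟩ := h4
    rw [s_apply_right] at h1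
    rw [s_apply_left] at h2
    omega
  exact hu ⟨_, _, _, s_lt_s hab h3, s_lt_s hbe h4, h1, h2⟩

theorem Removes.mul_s {v u : SInf} (hvu : Removes v u) {i : ℕ} (hi : u.1 (i + 1) < u.1 i) :
    Removes v (u * s i) := by
  intro k l hkl h
  rw [inv_mul_s_val, inv_mul_s_val] at h
  apply hvu k l hkl
  have h1 := s_lt_s (i := i) h (by
    rintro ⟨h2, h3⟩
    have h4 : (u⁻¹).1 l = i + 1 := by rw [← s_s_val i ((u⁻¹).1 l), h2, s_apply_left]
    have h5 : (u⁻¹).1 k = i := by rw [← s_s_val i ((u⁻¹).1 k), h3, s_apply_right]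
    have h6 : l = u.1 (i + 1) := by rw [← h4, apply_inv_val]
    have h7 : k = u.1 i := by rw [← h5, apply_inv_val]
    omega)
  rwa [s_s_val, s_s_val] at h1

/-- If `k + 1` precedes `k`, no larger entry lies between them, as it would complete a `231`; so the
larger entries before `k` are `k + 1` and those before `k + 1`. -/
theorem code_inv_succ {u : SInf} (hu : Avoids231 u) (k : ℕ) :
    (code u⁻¹ k ≤ code u⁻¹ (k + 1) ∧ (u⁻¹).1 k < (u⁻¹).1 (k + 1)) ∨
      (code u⁻¹ k = code u⁻¹ (k + 1) + 1 ∧ (u⁻¹).1 (k + 1) < (u⁻¹).1 k) := by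
  rcases lt_or_gt_of_ne (apply_ne_succ u⁻¹ k) with h | h
  · exact .inl ⟨code_le_code_succ h, h⟩
  · refine .inr ⟨?_, h⟩
    have e : {l : ℕ | k < l ∧ (u⁻¹).1 l < (u⁻¹).1 k} =
        insert (k + 1) {l : ℕ | k + 1 < l ∧ (u⁻¹).1 l < (u⁻¹).1 (k + 1)} := by
      ext l
      simp only [Set.mem_ofPred_eq, Set.mem_insert_iff]
      constructor
      · rintro ⟨h1, h2⟩
        by_cases h3 : l = k + 1
        · exact .inl h3
        · refine .inr ⟨by omega, ?_⟩
          by_contra h4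
          have h5 : (u⁻¹).1 l ≠ (u⁻¹).1 (k + 1) := fun h => h3 ((u⁻¹).1.injective h)
          apply hu
          refine ⟨(u⁻¹).1 (k + 1), (u⁻¹).1 l, (u⁻¹).1 k, by omega, h2, ?_⟩
          simp only [apply_inv_val]
          omega
      · rintro (rfl | ⟨h1, h2⟩)
        · exact ⟨by omega, h⟩
        · exact ⟨by omega, by omega⟩
    rw [code, e, Set.ncard_insert_of_notMem (by simp) (codeSet_finite _ _), code]

/-- Along `k`, the code of `u⁻¹` drops by at most one at each step. -/
theorem flag_mono {u : SInf} (hu : Avoids231 u) : Monotone fun k => k + 1 + code u⁻¹ k := by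
  apply monotone_nat_of_le_succ
  intro k
  rcases code_inv_succ hu k with h | h <;> omega

/-- Induction on the length of `u`, removing the descent of `exists_min_descent`. In the determinant
of the shorter modification only row `u.1 (i + 1)` has flag `i + 1`, so `ddX i` changes that row
alone. -/
theorem IsFam.modification {n : ℕ} {T : SInf → Poly} (hT : IsFam n T) {v : SInf}
    (hv : Fixes n v) (hd : IsDominant v) {u : SInf} (hu : Fixes n u) (ha : Avoids231 u)
    (hr : Removes v u) :
    T (v * u) = (jtMatrix n (fun k => k + 1 + code u⁻¹ k) (code v)
      fun k => (code v k : ℤ) - code u⁻¹ k).det := by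
  induction hm : inv u using Nat.strong_induction_on generalizing u with
  | _ m ih =>
  by_cases h1 : u = 1
  · subst h1
    have h0 : ∀ k, code (1 : SInf)⁻¹ k = 0 := fun k => by
      rw [_root_.inv_one]
      exact (fixes_one 0).code_eq_zero (Nat.zero_le k)
    simp only [h0, add_zero, Nat.cast_zero, sub_zero]
    rw [mul_one, hT.dominant hv hd, det_jtMatrix_diagram]
  · obtain ⟨i, k, rfl, hi, hmin, hpos⟩ := exists_min_descent h1
    have hin : i + 1 < n := hu.lt_of_lt_of_inv (by omega) hi
    have hkn : u.1 (i + 1) < n := hu.lt hin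
    have hlt := inv_mul_s_of_gt hi
    have hself := code_inv_mul_s_self hi
    have hdesc : (v * (u * s i)).1 (i + 1) < (v * (u * s i)).1 i := by
      simp only [mul_val, s_apply_left, s_apply_right]
      apply hr _ _ hi
      rw [inv_val_apply, inv_val_apply]
      omega
    have hstep := hT.ddX_of_descent (hv.mul (hu.mul (fixes_s hin))) hin hdesc
    rw [mul_assoc, mul_s_mul_s] at hstep
    rw [← hstep, ih _ (by omega) (hu.mul (fixes_s hin)) (avoids231_mul_s ha hi hmin) (hr.mul_s hi) rfl,
      ddX_det i _ ⟨u.1 (i + 1), hkn⟩]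
    · congr 1
      refine Matrix.ext fun l j => ?_
      by_cases hl : l = ⟨u.1 (i + 1), hkn⟩
      · subst hl
        rw [Matrix.updateRow_self, jtMatrix_apply, jtMatrix_apply]
        simp only
        rw [show u.1 (i + 1) + 1 + code (u * s i)⁻¹ (u.1 (i + 1)) = i + 1 by omega,
          ddX_coeffZ_gf, show u.1 (i + 1) + 1 + code u⁻¹ (u.1 (i + 1)) = i + 2 by omega, ← hself]
        push_cast
        ring_nf
      · have hl' : (l : ℕ) ≠ u.1 (i + 1) := fun h => hl (Fin.ext h)
        rw [Matrix.updateRow_ne hl, jtMatrix_apply, jtMatrix_apply, code_inv_mul_s_of_ne hi hl']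
    · intro l hl j
      have hl' : (l : ℕ) ≠ u.1 (i + 1) := fun h => hl (Fin.ext h)
      rw [jtMatrix_apply]
      apply sAct_coeffZ_gf
      rw [code_inv_mul_s_of_ne hi hl']
      -- Rows above have code zero and flag at most `u.1 (i + 1)`, hence below `i + 1`; rows below
      -- have flag at least `i + 2` by monotonicity for `u`.
      rcases lt_or_gt_of_ne hl' with h2 | h2
      · rw [hmin _ h2]; omega
      · have := flag_mono ha h2.le
        simp only at this
        omega

/-! ### The shape and the flags of an amenable permutation -/

/-- The entries counted by `code v k` split according to whether they come after or before `k` in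
the word of `u`. `Removes` ensures that all larger entries before `k` are counted and that no
smaller entry after `k` contributes to the code of `v * u`. -/
theorem code_modification {v u : SInf} (hr : Removes v u) (k : ℕ) :
    code (v * u) ((u⁻¹).1 k) + code u⁻¹ k = code v k := by
  have e : {l : ℕ | k < l ∧ v.1 l < v.1 k} =
      u.1 '' {j : ℕ | (u⁻¹).1 k < j ∧ (v * u).1 j < (v * u).1 ((u⁻¹).1 k)} ∪
        {l : ℕ | k < l ∧ (u⁻¹).1 l < (u⁻¹).1 k} := by
    ext l
    simp only [Set.mem_ofPred_eq, Set.mem_union, Set.mem_image, mul_val, apply_inv_val]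
    constructor
    · rintro ⟨h1, h2⟩
      have h3 : (u⁻¹).1 l ≠ (u⁻¹).1 k := fun h => by
        have := (u⁻¹).1.injective h
        omega
      rcases lt_or_gt_of_ne h3 with h4 | h4
      · exact .inr ⟨h1, h4⟩
      · exact .inl ⟨(u⁻¹).1 l, ⟨h4, by rwa [apply_inv_val]⟩, apply_inv_val u l⟩
    · rintro (⟨j, ⟨h1, h2⟩, rfl⟩ | ⟨h1, h2⟩)
      · refine ⟨?_, h2⟩
        by_contra h3
        rcases eq_or_lt_of_le (not_lt.1 h3) with h4 | h4
        · rw [h4] at h2; omega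
        · have := hr _ _ h4 (by rwa [inv_val_apply])
          omega
      · exact ⟨h1, hr _ _ h1 h2⟩
  rw [code, code, code, e, Set.ncard_union_eq ?_ ((codeSet_finite _ _).image _)
    (codeSet_finite _ _), Set.ncard_image_of_injective _ u.1.injective]
  · rw [Set.disjoint_left]
    rintro _ ⟨j, hj, rfl⟩ hl
    have h1 := hj.1
    have h2 := hl.2
    rw [inv_val_apply] at h2
    omega

theorem reduced_code_antitone {v u : SInf} (hd : IsDominant v) (ha : Avoids231 u)
    (hr : Removes v u) : Antitone fun k => code (v * u) ((u⁻¹).1 k) := by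
  apply antitone_nat_of_succ_le
  intro k
  have h1 := code_modification hr k
  have h2 := code_modification hr (k + 1)
  have h3 := hd (show k ≤ k + 1 by omega)
  rcases code_inv_succ ha k with h | h
  · omega
  · have := code_succ_lt_code (hr k (k + 1) (by omega) h.2)
    omega

/-- Let `m` be the last position of an entry at most `c`. A larger entry before `m` but after `c`
would form a `231` with `c` and `u.1 m`, so exactly `code u⁻¹ c` larger entries precede `m`. -/
theorem isGreatest_last {u : SInf} (ha : Avoids231 u) (c : ℕ) :
    IsGreatest {i : ℕ | u.1 i ≤ c} (c + code u⁻¹ c) := by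
  have hfin : {i : ℕ | u.1 i ≤ c}.Finite := by
    apply ((Set.finite_Iic c).image (u⁻¹).1).subset
    intro i hi
    exact ⟨u.1 i, hi, inv_val_apply u i⟩
  have hc : (u⁻¹).1 c ∈ {i : ℕ | u.1 i ≤ c} := by
    simp only [Set.mem_ofPred_eq, apply_inv_val]
    exact le_rfl
  obtain ⟨m, hm, hmax⟩ := hfin.exists_maximalFor id _ ⟨_, hc⟩
  have hmax' : ∀ i, u.1 i ≤ c → i ≤ m := by
    intro i hi
    by_contra h
    have := hmax hi (by simp only [id]; omega)
    simp only [id] at this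
    omega
  have h1 := position_eq (u := u) (p := m + 1) (k := c + 1) fun j hj => by
    have := hmax' ((u⁻¹).1 j) (by rw [apply_inv_val]; omega)
    omega
  have h2 : {l : ℕ | c + 1 ≤ l ∧ (u⁻¹).1 l < m + 1} =
      {l : ℕ | c < l ∧ (u⁻¹).1 l < (u⁻¹).1 c} := by
    have hcm := hmax' _ hc
    have hm' : u.1 m ≤ c := hm
    ext l
    simp only [Set.mem_ofPred_eq]
    constructor
    · rintro ⟨h3, h4⟩
      refine ⟨by omega, ?_⟩
      by_contra h5
      have h6 : (u⁻¹).1 l ≠ (u⁻¹).1 c := fun h => by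
        have := (u⁻¹).1.injective h
        omega
      have h7 : (u⁻¹).1 l ≠ m := fun h => by
        rw [← h, apply_inv_val] at hm'
        omega
      have h8 : u.1 m ≠ c := fun h => by
        rw [← h, inv_val_apply] at h5 h6
        omega
      apply ha
      refine ⟨(u⁻¹).1 c, (u⁻¹).1 l, m, by omega, by omega, ?_⟩
      simp only [apply_inv_val]
      omega
    · rintro ⟨h3, h4⟩
      exact ⟨by omega, by omega⟩
  rw [h2] at h1
  change m + 1 = c + 1 + code u⁻¹ c at h1
  have h3 : m = c + code u⁻¹ c := by omega
  rw [← h3]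
  exact ⟨hm, fun i hi => hmax' i hi⟩

theorem coeff_zero_gf (r t : ℕ) : PowerSeries.coeff 0 (gf r t) = 1 := by
  rw [PowerSeries.coeff_zero_eq_constantCoeff_apply, gf, map_mul, map_prod, map_prod,
    ← PowerSeries.coeff_zero_eq_constantCoeff]
  simp [geo]

/-- Changing the flags of a Jacobi–Trudi determinant by unitriangular row operations. -/
theorem det_jtMatrix_eq {n : ℕ} {F G f g : ℕ → ℕ} {μ : ℕ → ℤ} (q : ℕ → PowerSeries Poly)
    (hq : ∀ k < n, gf (F k) (G k) = q k * gf (f k) (g k))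
    (h0 : ∀ k < n, PowerSeries.coeff 0 (q k) = 1)
    (hin : ∀ k i, k + i < n → PowerSeries.coeff i (q k) ≠ 0 →
      f (k + i) = f k ∧ g (k + i) = g k ∧ μ (k + i) = μ k)
    (hout : ∀ k < n, ∀ i, n ≤ k + i →
      PowerSeries.coeff i (q k) = 0 ∨ ∀ j < n, μ k + (j : ℕ) - k < i) :
    (jtMatrix n F G μ).det = (jtMatrix n f g μ).det := by
  -- With equal parts and flags, passing from row `k` to row `k + i` lowers the degree by `i`, as
  -- multiplication by `T ^ i` does. So multiplication of the series by `q k` combines row `k` with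
  -- later rows of its block.
  apply det_eq_of_unitriangular (U := Matrix.of fun k l =>
    if (k : ℕ) ≤ l then PowerSeries.coeff ((l : ℕ) - k) (q k) else 0)
  · intro i j hij
    exact if_neg (not_le.2 (show (j : ℕ) < i from hij))
  · intro i
    rw [Matrix.of_apply, if_pos le_rfl, Nat.sub_self, h0 i i.2]
  · refine Matrix.ext fun k j => ?_
    simp only [Matrix.mul_apply, Matrix.of_apply, jtMatrix_apply]
    rw [hq k k.2, coeffZ_mul _ _ _ (n - k)]
    · set φ : ℕ → Poly := fun l => (if (k : ℕ) ≤ l then PowerSeries.coeff (l - (k : ℕ)) (q k)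
        else 0) * coeffZ (gf (f l) (g l)) (μ l + j - l) with hφ
      have hz : ∑ l ∈ Finset.range k, φ l = 0 := by
        refine Finset.sum_eq_zero fun l hl => ?_
        rw [Finset.mem_range] at hl
        simp only [hφ]
        rw [if_neg (by omega), zero_mul]
      rw [← Finset.sum_range φ, ← Finset.sum_range_add_sum_Ico φ k.2.le, hz, zero_add,
        Finset.sum_Ico_eq_sum_range]
      refine Finset.sum_congr rfl fun i hi => ?_
      rw [Finset.mem_range] at hi
      simp only [hφ]
      rw [if_pos (by omega), Nat.add_sub_cancel_left]
      by_cases hc : PowerSeries.coeff i (q k) = 0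
      · rw [hc, zero_mul, zero_mul]
      · obtain ⟨h1, h2, h3⟩ := hin k i (by omega) hc
        rw [h1, h2, h3]
        congr 2
        push_cast
        ring
    · intro i hi
      rcases hout k k.2 i (by omega) with h1 | h1
      · exact .inl h1
      · exact .inr (h1 j j.2)

section Amenable

variable {v u : SInf}

/-- The flags of consecutive equal parts differ by one linear factor. -/
theorem exists_gf_step (hd : IsDominant v) (ha : Avoids231 u) (hr : Removes v u) {k : ℕ}
    (e : code (v * u) ((u⁻¹).1 (k + 1)) = code (v * u) ((u⁻¹).1 k)) :
    ∃ a : Poly, gf (k + 1 + code u⁻¹ k) (code v k) =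
      (1 - PowerSeries.C a * PowerSeries.X) *
        gf (k + 1 + 1 + code u⁻¹ (k + 1)) (code v (k + 1)) := by
  have h1 := code_modification hr k
  have h2 := code_modification hr (k + 1)
  have h3 := hd (show k ≤ k + 1 by omega)
  rcases code_inv_succ ha k with h | h
  · refine ⟨x (k + 1 + code u⁻¹ k), ?_⟩
    rw [show k + 1 + 1 + code u⁻¹ (k + 1) = k + 1 + code u⁻¹ k + 1 by omega,
      show code v (k + 1) = code v k by omega]
    exact gf_eq_mul_gf_succ _ _
  · refine ⟨y (code v (k + 1)), ?_⟩
    rw [show code v k = code v (k + 1) + 1 by omega,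
      show k + 1 + code u⁻¹ k = k + 1 + 1 + code u⁻¹ (k + 1) by omega]
    exact gf_succ_right _ _

/-- Composes `d` linear factors; the degree bound `d` keeps the row operation inside the block of
equal parts. -/
theorem exists_gf_factor (hd : IsDominant v) (ha : Avoids231 u) (hr : Removes v u) (d : ℕ) {k : ℕ}
    (e : ∀ i < d, code (v * u) ((u⁻¹).1 (k + i + 1)) = code (v * u) ((u⁻¹).1 (k + i))) :
    ∃ q : PowerSeries Poly, gf (k + 1 + code u⁻¹ k) (code v k) =
      q * gf (k + d + 1 + code u⁻¹ (k + d)) (code v (k + d)) ∧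
      PowerSeries.coeff 0 q = 1 ∧ ∀ i, d < i → PowerSeries.coeff i q = 0 := by
  induction d generalizing k with
  | zero =>
    refine ⟨1, by rw [one_mul, add_zero], by simp, fun i hi => ?_⟩
    rw [PowerSeries.coeff_one, if_neg (by omega)]
  | succ d ih =>
    obtain ⟨q, h1, h2, h3⟩ := ih (k := k + 1) fun i hi => by
      have := e (i + 1) (by omega)
      rwa [show k + (i + 1) = k + 1 + i by omega] at this
    obtain ⟨a, h4⟩ := exists_gf_step hd ha hr (e 0 (by omega))
    refine ⟨(1 - PowerSeries.C a * PowerSeries.X) * q, ?_, ?_, fun i hi => ?_⟩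
    · rw [h4, show k + (d + 1) = k + 1 + d by omega, mul_assoc, ← h1]
    · rw [sub_mul, one_mul, map_sub, h2, mul_assoc, PowerSeries.coeff_C_mul,
        PowerSeries.coeff_zero_X_mul, mul_zero, sub_zero]
    · obtain ⟨i, rfl⟩ : ∃ j, i = j + 1 := ⟨i - 1, by omega⟩
      rw [sub_mul, one_mul, map_sub, mul_assoc, PowerSeries.coeff_C_mul,
        PowerSeries.coeff_succ_X_mul, h3 _ (by omega), h3 _ (by omega), mul_zero, sub_zero]

end Amenable

/-- If the code of `w` is weakly decreasing after the rearrangement `u⁻¹`, then this rearrangement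
of the code begins with the shape. -/
theorem exists_shape_eq {w u : SInf} (hm : Antitone fun k => code w ((u⁻¹).1 k)) :
    ∃ L, (∀ k, k < L ↔ code w ((u⁻¹).1 k) ≠ 0) ∧
      shape w = (List.range L).map fun k => code w ((u⁻¹).1 k) := by
  classical
  obtain ⟨n, hn⟩ := exists_fixes w
  have hex : ∃ k, code w ((u⁻¹).1 k) = 0 := by
    refine ⟨u.1 n, ?_⟩
    rw [inv_val_apply]
    exact hn.code_eq_zero le_rfl
  have hL : ∀ k, k < Nat.find hex ↔ code w ((u⁻¹).1 k) ≠ 0 := by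
    intro k
    constructor
    · exact fun h => Nat.find_min hex h
    · intro h
      by_contra hc
      have h1 := hm (not_lt.1 hc)
      simp only [Nat.find_spec hex] at h1
      omega
  refine ⟨Nat.find hex, hL, ?_⟩
  have hA : (Finset.range (rank w)).filter (fun i => code w i ≠ 0) =
      (Finset.range (Nat.find hex)).map (u⁻¹).1.toEmbedding := by
    ext i
    simp only [Finset.mem_filter, Finset.mem_range, Finset.mem_map, Equiv.coe_toEmbedding]
    constructor
    · rintro ⟨h1, h2⟩
      refine ⟨u.1 i, (hL _).2 ?_, inv_val_apply u i⟩
      rwa [inv_val_apply]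
    · rintro ⟨k, h1, rfl⟩
      refine ⟨?_, (hL k).1 h1⟩
      by_contra hc
      exact (hL k).1 h1 ((fixes_rank w).code_eq_zero (not_lt.1 hc))
  have hms : ((Multiset.range (rank w)).map (code w)).filter (· ≠ 0) =
      (((List.range (Nat.find hex)).map fun k => code w ((u⁻¹).1 k) : List ℕ) : Multiset ℕ) := by
    rw [Multiset.filter_map]
    have h1 := congrArg (fun s : Finset ℕ => s.val.map (code w)) hA
    simp only [Finset.filter_val, Finset.range_val, Finset.map_val, Multiset.map_map] at h1
    exact h1
  rw [shape, hms]
  apply List.Perm.eq_of_pairwise (le := (· ≥ ·))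
  · intro a b _ _ h1 h2
    exact le_antisymm h2 h1
  · exact Multiset.pairwise_sort _ _
  · rw [List.pairwise_map]
    exact List.pairwise_lt_range.imp fun h => hm h.le
  · rw [← Multiset.coe_eq_coe, Multiset.sort_eq]

/-- The flags in the theorem are those of the last row of each block of equal parts; row operations
reduce the flags of `IsFam.modification` to them. -/
theorem jacobiTrudi_amenable {n : ℕ} {v u : SInf} (hv : Fixes n v) (hu : Fixes n u)
    (hd : IsDominant v) (ha : Avoids231 u) (hr : Removes v u) :
    jacobiTrudi (rightFlag (v * u)) (leftFlag (v * u)) (fun j => (part (v * u) j : ℤ)) =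
      (jtMatrix n (fun k => k + 1 + code u⁻¹ k) (code v)
        fun k => (code v k : ℤ) - code u⁻¹ k).det := by
  set w := v * u with hw
  set m : ℕ → ℕ := fun k => code w ((u⁻¹).1 k) with hmdef
  have hm : Antitone m := reduced_code_antitone hd ha hr
  have hmod : ∀ k, m k + code u⁻¹ k = code v k := code_modification hr
  obtain ⟨L, hL, hshape⟩ := exists_shape_eq (w := w) (u := u) hm
  change ∀ k, k < L ↔ m k ≠ 0 at hL
  change shape w = (List.range L).map m at hshape
  have hlen : (shape w).length = L := by rw [hshape]; simp
  have hpart : ∀ j, part w j = m j := by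
    intro j
    rw [part, hshape]
    by_cases hj : j < L
    · simp [List.getD, hj]
    · have : m j = 0 := not_not.1 (mt (hL j).2 hj)
      simp [List.getD, hj, this]
  have hmn : ∀ k, n ≤ k → m k = 0 := by
    intro k hk
    simp only [hmdef]
    rw [hu.inverse k hk]
    exact (hv.mul hu).code_eq_zero hk
  have hLn : L ≤ n := by
    by_contra hc
    exact (hL n).1 (not_le.1 hc) (hmn n le_rfl)
  have hcorner : ∀ j < L, j ≤ corner w j ∧ m (corner w j + 1) < m (corner w j) := by
    intro j hj
    have hne : {c : ℕ | j ≤ c ∧ part w (c + 1) < part w c}.Nonempty := by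
      by_contra hcon
      rw [Set.not_nonempty_iff_eq_empty, Set.eq_empty_iff_forall_notMem] at hcon
      simp only [Set.mem_ofPred_eq, hpart, not_and, not_lt] at hcon
      have h1 : ∀ d, m j ≤ m (j + d) := by
        intro d
        induction d with
        | zero => exact le_rfl
        | succ d ih => exact ih.trans (hcon (j + d) (by omega))
      have h2 := h1 n
      rw [hmn (j + n) (by omega)] at h2
      exact (hL j).1 hj (by omega)
    have h3 : j ≤ corner w j ∧ part w (corner w j + 1) < part w (corner w j) := Nat.sInf_mem hne
    rwa [hpart, hpart] at h3
  have hconst : ∀ j < L, ∀ k, j ≤ k → k < corner w j → m (k + 1) = m k := by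
    intro j hj k h1 h2
    have h3 : k ∉ {c : ℕ | j ≤ c ∧ part w (c + 1) < part w c} := Nat.notMem_of_lt_sInf h2
    simp only [Set.mem_ofPred_eq, hpart, not_and, not_lt] at h3
    exact le_antisymm (hm (Nat.le_succ k)) (h3 h1)
  have heq : ∀ j < L, ∀ k, j ≤ k → k ≤ corner w j → m k = m j := by
    intro j hj k h1
    induction k, h1 using Nat.le_induction with
    | base => exact fun _ => rfl
    | succ k hk ih =>
      intro h2
      rw [hconst j hj k hk (by omega), ih (by omega)]
  have hsame : ∀ j < L, ∀ k, j ≤ k → k ≤ corner w j → corner w k = corner w j := by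
    intro j hj k h1 h2
    have h3 := hcorner j hj
    apply le_antisymm
    · apply Nat.sInf_le
      simp only [Set.mem_ofPred_eq, hpart]
      exact ⟨h2, h3.2⟩
    · have hkL : k < L := by
        rw [hL, heq j hj k h1 h2]
        exact (hL j).1 hj
      have h4 := hcorner k hkL
      apply Nat.sInf_le
      simp only [Set.mem_ofPred_eq, hpart]
      exact ⟨by omega, h4.2⟩
  have hcL : ∀ j < L, corner w j < L := by
    intro j hj
    rw [hL]
    have := (hcorner j hj).2
    omega
  have hright : ∀ j < L, rightFlag w j = ((corner w j + 1 + code u⁻¹ (corner w j) : ℕ) : ℤ) := by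
    intro j hj
    -- Positions whose code is at least the `j`-th part are those whose entry in `u` is at most the
    -- corner, and `isGreatest_last` finds the last one. The flag adds one as positions are counted
    -- from `1`.
    have h1 : {i : ℕ | part w j ≤ code w i} = {i : ℕ | u.1 i ≤ corner w j} := by
      ext i
      have h2 : code w i = m (u.1 i) := by simp only [hmdef, inv_val_apply]
      have h3 := hcorner j hj
      rw [Set.mem_ofPred_eq, Set.mem_ofPred_eq, hpart, h2, ← heq j hj _ h3.1 le_rfl]
      constructor
      · intro h
        by_contra hc
        have := hm (show corner w j + 1 ≤ u.1 i by omega)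
        omega
      · exact fun h => hm h
    rw [rightFlag, hlen, if_pos hj, h1, (isGreatest_last ha _).csSup_eq]
    push_cast
    ring
  have hleft : ∀ j < L, leftFlag w j = ((code v (corner w j) : ℕ) : ℤ) := by
    intro j hj
    have h1 := hcorner j hj
    -- In `f_c + λ_c - c` the corner index cancels, leaving `code u⁻¹ + m = code v` at the corner.
    rw [leftFlag, hlen, if_pos hj, hright _ (hcL j hj), hsame j hj _ h1.1 le_rfl, hpart, ← hmod]
    push_cast
    ring
  have eF : rightFlag w =
      fun k => ((if k < L then corner w k + 1 + code u⁻¹ (corner w k) else 0 : ℕ) : ℤ) := by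
    funext k
    split_ifs with hk
    · exact hright k hk
    · rw [rightFlag, hlen, if_neg hk, Nat.cast_zero]
  have eG : leftFlag w = fun k => ((if k < L then code v (corner w k) else 0 : ℕ) : ℤ) := by
    funext k
    split_ifs with hk
    · exact hleft k hk
    · rw [leftFlag, hlen, if_neg hk, Nat.cast_zero]
  have eμ : (fun k => (code v k : ℤ) - code u⁻¹ k) = fun k => (m k : ℤ) := by
    funext k
    rw [← hmod k]
    push_cast
    ring
  have eα : (fun j => (part w j : ℤ)) = fun k => (m k : ℤ) := by
    funext k
    rw [hpart]
  rw [eF, eG, eα, eμ, jacobiTrudi_eq_det (n := n)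
    (F := fun k => if k < L then corner w k + 1 + code u⁻¹ (corner w k) else 0)
    (G := fun k => if k < L then code v (corner w k) else 0)
    (fun k hk => if_neg (by omega)) (fun k hk => if_neg (by omega))
    (fun k hk => by rw [hmn k hk, Nat.cast_zero])]
  have hfac : ∀ k, ∃ q : PowerSeries Poly,
      gf (k + 1 + code u⁻¹ k) (code v k) = q *
        gf (if k < L then corner w k + 1 + code u⁻¹ (corner w k) else 0)
          (if k < L then code v (corner w k) else 0) ∧
      PowerSeries.coeff 0 q = 1 ∧ (k < L → ∀ i, corner w k < k + i → PowerSeries.coeff i q = 0) := by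
    intro k
    by_cases hk : k < L
    · have h1 := (hcorner k hk).1
      obtain ⟨q, h2, h3, h4⟩ := exists_gf_factor hd ha hr (corner w k - k) (k := k)
        fun i hi => hconst k hk (k + i) (by omega) (by omega)
      rw [Nat.add_sub_cancel' h1] at h2
      refine ⟨q, by rw [if_pos hk, if_pos hk, h2], h3, fun _ i hi => h4 i (by omega)⟩
    -- Past the last part the target flags are zero and the target series is `1`, so the whole
    -- series serves as the factor.
    · refine ⟨gf (k + 1 + code u⁻¹ k) (code v k), by rw [if_neg hk, if_neg hk, gf_zero_zero, mul_one], coeff_zero_gf _ _,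
        fun h => absurd h hk⟩
  choose q hq1 hq2 hq3 using hfac
  symm
  refine det_jtMatrix_eq q (fun k _ => hq1 k) (fun k _ => hq2 k) ?_ ?_
  · intro k i _ hi
    by_cases hk : k < L
    · have h1 : k + i ≤ corner w k := by
        by_contra hc
        exact hi (hq3 k hk i (by omega))
      have h2 := hcL k hk
      rw [if_pos (show k + i < L by omega), if_pos hk, if_pos (show k + i < L by omega), if_pos hk,
        hsame k hk _ (by omega) h1, heq k hk _ (by omega) h1]
      exact ⟨rfl, rfl, rfl⟩
    · have h1 : m k = 0 := not_not.1 (mt (hL k).2 hk)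
      have h2 : m (k + i) = 0 := not_not.1 (mt (hL (k + i)).2 (by omega))
      rw [if_neg (show ¬ k + i < L by omega), if_neg hk, if_neg (show ¬ k + i < L by omega),
        if_neg hk, h1, h2]
      exact ⟨rfl, rfl, rfl⟩
  · intro k hk i hi
    by_cases hkL : k < L
    · left
      have := hcL k hkL
      exact hq3 k hkL i (by omega)
    -- Here the factor need not be a polynomial, but the part is zero, so the degree `j - k` of
    -- every entry is below `n - k ≤ i`.
    · right
      intro j hj
      have h1 : m k = 0 := not_not.1 (mt (hL k).2 hkL)
      rw [h1]
      omega

theorem schubert_amenable {w : SInf} (hw : IsAmenable w) :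
    schubert w = jacobiTrudi (rightFlag w) (leftFlag w) (fun j => (part w j : ℤ)) := by
  obtain ⟨v, hd, u, ha, rfl, hl⟩ := hw
  obtain ⟨a, hv⟩ := exists_fixes v
  obtain ⟨b, hu⟩ := exists_fixes u
  have hv' : Fixes (a + b) v := hv.mono (by omega)
  have hu' : Fixes (a + b) u := hu.mono (by omega)
  have hr := removes_of_length hl
  rw [(isFam_schubert (a + b)).modification hv' hd hu' ha hr, jacobiTrudi_amenable hv' hu' hd ha hr]

end

end TypeA

open TypeA in
/-- There is exactly one family of double Schubert polynomials, and its member at any amenable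
permutation is the flagged Jacobi–Trudi expression. -/
theorem theorem2 :
    (∃! S : SInf → Poly, IsDoubleSchubertFamily S) ∧
    ∀ S : SInf → Poly, IsDoubleSchubertFamily S →
      ∀ w : SInf, IsAmenable w →
        S w = jacobiTrudi (rightFlag w) (leftFlag w) (fun j => (part w j : ℤ)) := by
  refine ⟨existsUnique_isDoubleSchubertFamily, fun S hS w hw => ?_⟩
  rw [hS.unique isDoubleSchubertFamily_schubert]
  exact schubert_amenable hw
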